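/- Fix an integer $d\ge 2$. For reals $a<b$, the vertical slab $[\![H_a,H_b]\!]$ is $\{x\in\mathbb R^d: a\le x_1\le b\}$. Let $S\subset\mathbb R^d$ be a set of $n$ points, no two with the same first coordinate and with all $\binom n2$ pairwise Euclidean distances distinct. Write $CP(S,H_a,H_b)$ for the unordered pair of distinct points of $S\cap[\![H_a,H_b]\!]$ at smallest distance, and put $CP(S,H_a,H_b)=\infty$ if this set has at most one point. Let $1\le m\le n$ be integers with $m\mid n$, and let $a_1<\dots<a_{m+1}$ be reals such that, for each $1\le i\le m$, exactly $n/m$ points of $S$ lie in the interior of $[\![H_{a_i},H_{a_{i+1}}]\!]$. Put $A(S,m)=\{CP(S,H_{a_i},H_{a_j}):1\le i<j\le m+1\}$, and let $f_d(n,m)$ be the maximum of $|A(S,m)|$ over all such $S$ and $a_1,\dots,a_{m+1}$. Then: 1. If $m=O(\sqrt n)$, then $f_d(n,m)=\Theta(m^2)$. That is, for every $C>0$ there are $c_1,c_2>0$, depending only on $d$ and $C$, such that $c_1m^2\le f_d(n,m)\le c_2m^2$ for all integers $1\le m\le n$ with $m\mid n$ and $m\le C\sqrt n$. 2. If $m=\omega(\sqrt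 n)$, then $f_d(n,m)=\Theta(n\log(m/\sqrt n))$. That is, there are $K>1$ and $c_1,c_2>0$, depending only on $d$, such that $c_1\,n\log(m/\sqrt n)\le f_d(n,m)\le c_2\,n\log(m/\sqrt n)$ for all integers $1\le m\le n$ with $m\mid n$ and $m\ge K\sqrt n$. 3. In particular, $f_d(n,n)=\Theta(n\log n)$: there are $c_1,c_2>0$, depending only on $d$, such that $c_1\,n\log n\le f_d(n,n)\le c_2\,n\log n$ for all $n\ge 2$. -/

import Mathlib

namespace SlabClosestPair

/-- `d`-dimensional Euclidean space. -/
abbrev Pt (d : ℕ) : Type := EuclideanSpace ℝ (Fin d)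

/-- The closed vertical slab of all points whose first coordinate lies in `[a, b]`. -/
def slab (d : ℕ) [NeZero d] (a b : ℝ) : Set (Pt d) := {x | a ≤ x 0 ∧ x 0 ≤ b}

/-- The interior of the vertical slab with first coordinates between `a` and `b`. -/
def openSlab (d : ℕ) [NeZero d] (a b : ℝ) : Set (Pt d) := {x | a < x 0 ∧ x 0 < b}

/-- No two points of `S` have the same first coordinate, and the distances of the unordered pairs
of distinct points of `S` are pairwise different. -/
structure GeneralPosition {d : ℕ} [NeZero d] (S : Finset (Pt d)) : Prop where
  fst_injOn : ∀ p ∈ S, ∀ q ∈ S, p 0 = q 0 → p = q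
  dist_inj : ∀ p ∈ S, ∀ q ∈ S, ∀ p' ∈ S, ∀ q' ∈ S, p ≠ q → p' ≠ q' →
    dist p q = dist p' q' → s(p, q) = s(p', q')

/-- The unordered pair `e` is a closest pair among the points of `T`. -/
def IsClosestPair {d : ℕ} (T : Set (Pt d)) (e : Sym2 (Pt d)) : Prop :=
  ∃ p ∈ T, ∃ q ∈ T, p ≠ q ∧ e = s(p, q) ∧
    ∀ p' ∈ T, ∀ q' ∈ T, p' ≠ q' → dist p q ≤ dist p' q'

open Classical in
/-- The closest pair among the points of `S` in the slab between `a` and `b`; its value is `⊤`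
(that is, `∞`) if there are fewer than two such points. -/
noncomputable def CP {d : ℕ} [NeZero d] (S : Finset (Pt d)) (a b : ℝ) : WithTop (Sym2 (Pt d)) :=
  if h : ∃ e, IsClosestPair (slab d a b ∩ (S : Set (Pt d))) e then ((h.choose : Sym2 (Pt d)) :)
  else ⊤

/-- The set of closest pairs over all slabs bounded by two of the hyperplanes with first
coordinates `a 0 < a 1 < ... < a m`. -/
def A {d : ℕ} [NeZero d] (S : Finset (Pt d)) {m : ℕ} (a : Fin (m + 1) → ℝ) :
    Set (WithTop (Sym2 (Pt d))) :=
  {x | ∃ i j : Fin (m + 1), i < j ∧ x = CP S (a i) (a j)}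

/-- `S` consists of `n` points in general position, and exactly `n / m` of them lie strictly
between any two consecutive hyperplanes with first coordinates `a 0 < a 1 < ... < a m`
(used only when `m` divides `n`). -/
structure Admissible {d : ℕ} [NeZero d] (n m : ℕ) (S : Finset (Pt d))
    (a : Fin (m + 1) → ℝ) : Prop where
  card_eq : S.card = n
  generalPosition : GeneralPosition S
  strictMono : StrictMono a
  card_between : ∀ i : Fin m,
    ((S : Set (Pt d)) ∩ openSlab d (a i.castSucc) (a i.succ)).ncard = n / m

/-- The possible values of `|A(S, m)|`. -/
def counts (d : ℕ) [NeZero d] (n m : ℕ) : Set ℕ :=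
  {k | ∃ (S : Finset (Pt d)) (a : Fin (m + 1) → ℝ), Admissible n m S a ∧ k = (A S a).ncard}

/-- The largest possible number `f_d(n, m)` of different closest pairs. The set `counts d n m` is
bounded above, so the supremum is a maximum as soon as the set is nonempty; in particular
whenever `0 < f d n m`. -/
noncomputable def f (d : ℕ) [NeZero d] (n m : ℕ) : ℕ := sSup (counts d n m)

/-- A closest pair exists exactly when there are at least two points. -/
theorem exists_isClosestPair_iff {d : ℕ} {T : Set (Pt d)} (hT : T.Finite) :
    (∃ e, IsClosestPair T e) ↔ T.Nontrivial := by
  constructor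
  · rintro ⟨e, p, hp, q, hq, hpq, -⟩
    exact ⟨p, hp, q, hq, hpq⟩
  · rintro ⟨p, hp, q, hq, hpq⟩
    have hfin : {z : Pt d × Pt d | z ∈ T ×ˢ T ∧ z.1 ≠ z.2}.Finite :=
      (hT.prod hT).subset fun z hz => hz.1
    obtain ⟨z, hz, hmin⟩ := Set.exists_min_image _ (fun z : Pt d × Pt d => dist z.1 z.2) hfin
      ⟨(p, q), ⟨hp, hq⟩, hpq⟩
    exact ⟨s(z.1, z.2), z.1, hz.1.1, z.2, hz.1.2, hz.2, rfl,
      fun p' hp' q' hq' h => hmin (p', q') ⟨⟨hp', hq'⟩, h⟩⟩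

/-- In general position there is only one closest pair. -/
theorem IsClosestPair.unique {d : ℕ} [NeZero d] {S : Finset (Pt d)} (hS : GeneralPosition S)
    {T : Set (Pt d)} (hT : T ⊆ S) {e e' : Sym2 (Pt d)}
    (he : IsClosestPair T e) (he' : IsClosestPair T e') : e = e' := by
  obtain ⟨p, hp, q, hq, hpq, rfl, h⟩ := he
  obtain ⟨p', hp', q', hq', hpq', rfl, h'⟩ := he'
  exact hS.dist_inj p (hT hp) q (hT hq) p' (hT hp') q' (hT hq') hpq hpq'
    (le_antisymm (h p' hp' q' hq' hpq') (h' p hp q hq hpq))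

/-- The set of possible values is bounded above. -/
theorem bddAbove_counts (d : ℕ) [NeZero d] (n m : ℕ) : BddAbove (counts d n m) := by
  refine ⟨(Set.univ : Set (Fin (m + 1) × Fin (m + 1))).ncard, ?_⟩
  rintro k ⟨S, a, -, rfl⟩
  have hsub : A S a ⊆
      (fun z : Fin (m + 1) × Fin (m + 1) => CP S (a z.1) (a z.2)) '' Set.univ := by
    rintro x ⟨i, j, -, rfl⟩
    exact ⟨(i, j), trivial, rfl⟩
  exact (Set.ncard_le_ncard hsub (Set.toFinite _)).trans (Set.ncard_image_le (Set.toFinite _))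

end SlabClosestPair

/-!
Both bounds come from a divide and conquer over the hyperplanes.

*Upper bound.* Cut at a middle hyperplane. The closest pair of a slab that contains the cut is the
closest pair of one of the two parts, or its points lie on both sides of the cut (`CP_split`). There
are only `O(N)` pairs of the last kind among `N` points (`exists_card_crossingPairs_le`): all points
in the slab of a crossing pair of length `ℓ` have distances at least `ℓ`, so the pair is determined
by the net points near its ends in a net of scale a little below `ℓ`. Of two such net points at
least one disappears from the nets of scale a little above `ℓ`, and by packing it serves for boundedly
many pairs of this scale. In nested nets each point disappears once, so in total `O(N)` pairs are
charged. Now `A(S, m)` is estimated by a binary recursion over the `m` strips, which has linear cost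
`O(n)` on each level and is stopped at blocks of about `n / m` strips, where the number of slabs is
itself small enough. This leaves `O(log (m / (n / m))) = O(log (m / √n))` levels
(`ncard_closestPairsBetween_le`).

*Lower bound.* First coordinates only matter for the order of the points, because all other
distances can be scaled up; so the task is to find a sequence of integers in which many intervals
have different closest pairs (`exists_points`). Repeating a sequence backwards, with tiny
perturbations that decrease away from the middle, makes each pair that is symmetric about the middle
the closest pair of its interval, and keeps the closest pairs of both halves. Iterating this gives
the folded sequence (`foldSeq`, `abs_foldSeq_sub_lt`), a perturbed reflected Gray code, with `n / 2`
such pairs on each of `log n` levels. For strips with several points, shifted copies of the folded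
sequence are placed far from each other, one point of each copy to a strip. The copy with shift `τ`
is responsible for the slabs with midpoint `h - τ`, where `h` is the middle of a dyadic block. As
long as the shifts are short compared with the block, they produce different slabs, and the closest
pair of each of these has its ends in the two extreme strips (`exists_abs_stripSeq_sub_lt`), so
different slabs have different closest pairs. Counting the slabs (`exists_isFoldSlab_finset`) gives
both lower bounds: one level of blocks for `m = O(√n)`, and about `log (m / √n)` levels, each with
a multiple of `n` slabs, for larger `m`.
-/

namespace SlabClosestPair

/-! ### Packing and nested nets -/

/-- A set with pairwise distances at least `r` has boundedly many points in a ball of radius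
`R * r`, with a bound that does not depend on `r`. -/
theorem exists_packing_bound (d : ℕ) (R : ℝ) : ∃ C : ℕ, ∀ (r : ℝ), 0 < r → ∀ (z : Pt d)
    (T : Finset (Pt d)), (∀ u ∈ T, dist u z ≤ R * r) →
      (∀ u ∈ T, ∀ v ∈ T, u ≠ v → r ≤ dist u v) → T.card ≤ C := by
  obtain ⟨t, -, htf, ht⟩ := (isCompact_closedBall (0 : Pt d) R).finite_cover_balls
    (show (0 : ℝ) < 1 / 2 by norm_num)
  refine ⟨htf.toFinset.card, fun r hr z T hT hsep => ?_⟩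
  have hex : ∀ u ∈ T, ∃ y ∈ t, dist (r⁻¹ • (u - z)) y < 1 / 2 := by
    intro u hu
    have hmem : r⁻¹ • (u - z) ∈ Metric.closedBall (0 : Pt d) R := by
      rw [mem_closedBall_zero_iff, norm_smul, norm_inv, Real.norm_of_nonneg hr.le,
        ← dist_eq_norm, inv_mul_le_iff₀ hr, mul_comm]
      exact hT u hu
    simpa using ht hmem
  choose! y hyt hy using hex
  refine Finset.card_le_card_of_injOn y (fun u hu => by simpa using hyt u hu) ?_
  intro u hu v hv huv
  by_contra hne
  have h1 : dist (r⁻¹ • (u - z)) (r⁻¹ • (v - z)) < 1 := by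
    have h2 := hy v hv
    rw [← huv, dist_comm] at h2
    linarith [dist_triangle (r⁻¹ • (u - z)) (y u) (r⁻¹ • (v - z)), hy u hu]
  rw [dist_smul₀, dist_sub_right, norm_inv, Real.norm_of_nonneg hr.le, inv_mul_lt_iff₀ hr] at h1
  linarith [hsep u hu v hv hne]

/-- A separated subset of a finite set extends to a separated subset that is also a covering. -/
theorem exists_separated_covering {X : Type*} [MetricSpace X] {P Q : Finset X} (hQ : Q ⊆ P)
    {r : ℝ} (hr : 0 < r) (hsep : ∀ u ∈ Q, ∀ v ∈ Q, u ≠ v → r ≤ dist u v) :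
    ∃ Q' : Finset X, Q ⊆ Q' ∧ Q' ⊆ P ∧ (∀ u ∈ Q', ∀ v ∈ Q', u ≠ v → r ≤ dist u v) ∧
      ∀ w ∈ P, ∃ u ∈ Q', dist w u < r := by
  classical
  have hfin : {T : Finset X | T ⊆ P ∧ ∀ u ∈ T, ∀ v ∈ T, u ≠ v → r ≤ dist u v}.Finite :=
    P.powerset.finite_toSet.subset fun T hT => by simpa using hT.1
  obtain ⟨T, hQT, hT⟩ := hfin.exists_le_maximal (a := Q) ⟨hQ, hsep⟩
  refine ⟨T, hQT, hT.prop.1, hT.prop.2, fun w hw => ?_⟩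
  by_contra! hfar
  have hins : insert w T ∈ {T : Finset X | T ⊆ P ∧ ∀ u ∈ T, ∀ v ∈ T, u ≠ v → r ≤ dist u v} := by
    refine ⟨Finset.insert_subset hw hT.prop.1, ?_⟩
    intro u hu v hv huv
    rcases Finset.mem_insert.1 hu with rfl | hu' <;> rcases Finset.mem_insert.1 hv with rfl | hv'
    · exact absurd rfl huv
    · exact hfar v hv'
    · rw [dist_comm]; exact hfar u hu'
    · exact hT.prop.2 u hu' v hv' huv
  have hwT : w ∈ T := hT.le_of_ge hins (Finset.subset_insert w T) (Finset.mem_insert_self w T)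
  have := hfar w hwT
  rw [dist_self] at this
  linarith

/-- Every finite metric space has an increasing sequence of nets at the scales `R / 2 ^ k`. -/
theorem exists_nested_nets {X : Type*} [MetricSpace X] (P : Finset X) {R : ℝ} (hR : 0 < R) :
    ∃ N : ℕ → Finset X, Monotone N ∧ (∀ k, N k ⊆ P) ∧
      (∀ k, ∀ u ∈ N k, ∀ v ∈ N k, u ≠ v → R / 2 ^ k ≤ dist u v) ∧
      ∀ k, ∀ w ∈ P, ∃ u ∈ N k, dist w u < R / 2 ^ k := by
  let Sep (k : ℕ) : Type _ :=
    {Q : Finset X // Q ⊆ P ∧ (∀ u ∈ Q, ∀ v ∈ Q, u ≠ v → R / 2 ^ k ≤ dist u v) ∧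
      ∀ w ∈ P, ∃ u ∈ Q, dist w u < R / 2 ^ k}
  have h0 : Nonempty (Sep 0) := by
    obtain ⟨Q, -, h1, h2, h3⟩ := exists_separated_covering (P := P) (Finset.empty_subset P)
      (r := R / 2 ^ 0) (by positivity) (by simp)
    exact ⟨⟨Q, h1, h2, h3⟩⟩
  have hstep : ∀ k (Q : Sep k), ∃ Q' : Sep (k + 1), Q.1 ⊆ Q'.1 := by
    rintro k ⟨Q, hQ, hsep, -⟩
    obtain ⟨Q', h0, h1, h2, h3⟩ := exists_separated_covering hQ (r := R / 2 ^ (k + 1))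
      (by positivity) (fun u hu v hv huv => le_trans (by gcongr <;> simp) (hsep u hu v hv huv))
    exact ⟨⟨Q', h1, h2, h3⟩, h0⟩
  choose next hnext using hstep
  let N : (k : ℕ) → Sep k := fun k => Nat.rec h0.some next k
  exact ⟨fun k => (N k).1, monotone_nat_of_le_succ fun k => hnext k (N k), fun k => (N k).2.1,
    fun k => (N k).2.2.1, fun k => (N k).2.2.2⟩

/-! ### Closest pairs that cross a hyperplane -/

open Classical in
/-- The pairs `(p, q)` of points of `P` on the two sides of the hyperplane with first coordinate
`h` that are closest among the points of `P` in the smallest slab containing both. -/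
noncomputable def crossingPairs {d : ℕ} [NeZero d] (P : Finset (Pt d)) (h : ℝ) :
    Finset (Pt d × Pt d) :=
  {e ∈ P ×ˢ P | e.1 0 < h ∧ h < e.2 0 ∧ ∀ p ∈ P, ∀ q ∈ P, p ∈ slab d (e.1 0) (e.2 0) →
    q ∈ slab d (e.1 0) (e.2 0) → p ≠ q → dist e.1 e.2 ≤ dist p q}

theorem mem_crossingPairs {d : ℕ} [NeZero d] {P : Finset (Pt d)} {h : ℝ} {e : Pt d × Pt d} :
    e ∈ crossingPairs P h ↔ (e.1 ∈ P ∧ e.2 ∈ P) ∧ e.1 0 < h ∧ h < e.2 0 ∧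
      ∀ p ∈ P, ∀ q ∈ P, p ∈ slab d (e.1 0) (e.2 0) → q ∈ slab d (e.1 0) (e.2 0) → p ≠ q →
        dist e.1 e.2 ≤ dist p q := by
  classical
  simp [crossingPairs]

/-- Two crossing pairs of length at least `ℓ` whose left ends are closer than `ℓ` have the same left
end: otherwise the one reaching further left has both left ends in its slab. -/
theorem crossingPairs_fst_eq {d : ℕ} [NeZero d] {P : Finset (Pt d)} {h ℓ : ℝ} {e e' : Pt d × Pt d}
    (he : e ∈ crossingPairs P h) (he' : e' ∈ crossingPairs P h) (hℓ : ℓ ≤ dist e.1 e.2)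
    (hℓ' : ℓ ≤ dist e'.1 e'.2) (hdist : dist e.1 e'.1 < ℓ) : e.1 = e'.1 := by
  rw [mem_crossingPairs] at he he'
  obtain ⟨⟨h1, h2⟩, h3, h4, h5⟩ := he
  obtain ⟨⟨h1', h2'⟩, h3', h4', h5'⟩ := he'
  by_contra hne
  rcases le_total (e.1 0) (e'.1 0) with hle | hle
  · have := h5 _ h1 _ h1' ⟨le_rfl, by linarith⟩ ⟨hle, by linarith⟩ hne
    linarith
  · have := h5' _ h1 _ h1' ⟨hle, by linarith⟩ ⟨le_rfl, by linarith⟩ hne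
    linarith

theorem crossingPairs_snd_eq {d : ℕ} [NeZero d] {P : Finset (Pt d)} {h ℓ : ℝ} {e e' : Pt d × Pt d}
    (he : e ∈ crossingPairs P h) (he' : e' ∈ crossingPairs P h) (hℓ : ℓ ≤ dist e.1 e.2)
    (hℓ' : ℓ ≤ dist e'.1 e'.2) (hdist : dist e.2 e'.2 < ℓ) : e.2 = e'.2 := by
  rw [mem_crossingPairs] at he he'
  obtain ⟨⟨h1, h2⟩, h3, h4, h5⟩ := he
  obtain ⟨⟨h1', h2'⟩, h3', h4', h5'⟩ := he'
  by_contra hne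
  rcases le_total (e.2 0) (e'.2 0) with hle | hle
  · have := h5' _ h2 _ h2' ⟨by linarith, hle⟩ ⟨by linarith, le_rfl⟩ hne
    linarith
  · have := h5 _ h2 _ h2' ⟨by linarith, le_rfl⟩ ⟨by linarith, hle⟩ hne
    linarith

/-- A fixed hyperplane is crossed by only linearly many closest pairs. A crossing pair whose length
is comparable to the scale `k` is determined by the net points, at a slightly finer scale, near its
two ends. These two net points are too close to each other to survive both in a slightly coarser
net, so the pair can be charged to a point that enters the nets at about the scale `k`. -/
theorem exists_card_crossingPairs_le (d : ℕ) [NeZero d] :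
    ∃ C : ℕ, ∀ (P : Finset (Pt d)) (h : ℝ), (crossingPairs P h).card ≤ C * P.card := by
  classical
  obtain ⟨C, hC⟩ := exists_packing_bound d 18
  refine ⟨5 * (C + C), fun P h => ?_⟩
  obtain ⟨D, hD⟩ : ∃ D : ℝ, ∀ p ∈ P, ∀ q ∈ P, dist p q ≤ D := by
    obtain ⟨D, hD⟩ := Metric.isBounded_iff.1 P.finite_toSet.isBounded
    exact ⟨D, fun p hp q hq => hD hp hq⟩
  set R : ℝ := 2 * (|D| + 1) with hRdef
  have hR : 0 < R := by positivity
  obtain ⟨N, hmono, hNP, hsep, hcov⟩ := exists_nested_nets P hR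
  choose! ν hνN hν using hcov
  let ρ : ℕ → ℝ := fun j => R / 2 ^ (j + 5)
  have hρ : ∀ j, 0 < ρ j := fun j => by positivity
  have hρ5 : ∀ j, R / 2 ^ j = 32 * ρ j := fun j => by
    simp only [ρ, pow_add]; field_simp; norm_num
  let κ : Pt d → ℕ := fun z => sInf {k | z ∈ N k}
  -- the pairs of scale `j` whose left, respectively right, end is represented by `z`
  let F₁ : Pt d → ℕ → Finset (Pt d × Pt d) := fun z j =>
    {e ∈ crossingPairs P h | (8 * ρ j < dist e.1 e.2 ∧ dist e.1 e.2 ≤ 16 * ρ j) ∧ ν (j + 5) e.1 = z}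
  let F₂ : Pt d → ℕ → Finset (Pt d × Pt d) := fun z j =>
    {e ∈ crossingPairs P h | (8 * ρ j < dist e.1 e.2 ∧ dist e.1 e.2 ≤ 16 * ρ j) ∧ ν (j + 5) e.2 = z}
  have hnu : ∀ j, ∀ p ∈ P, dist p (ν (j + 5) p) < ρ j := fun j p hp => hν (j + 5) p hp
  have hclose : ∀ j, ∀ p ∈ P, ∀ q ∈ P, ν (j + 5) p = ν (j + 5) q → dist p q < 2 * ρ j := by
    intro j p hp q hq hpq
    have h1 := hnu j p hp
    have h2 := hnu j q hq
    rw [← hpq, dist_comm] at h2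
    linarith [dist_triangle p (ν (j + 5) p) q]
  have hnet : ∀ j, ∀ p ∈ P, ∀ q ∈ P, dist p q ≤ 16 * ρ j →
      dist (ν (j + 5) p) (ν (j + 5) q) < 18 * ρ j := by
    intro j p hp q hq hpq
    have h1 := hnu j p hp
    have h2 := hnu j q hq
    rw [dist_comm] at h1
    linarith [dist_triangle4 (ν (j + 5) p) p q (ν (j + 5) q)]
  have hF₁ : ∀ z j, (F₁ z j).card ≤ C := by
    intro z j
    have hinj : Set.InjOn (fun e : Pt d × Pt d => ν (j + 5) e.2) (F₁ z j) := by
      intro e he e' he' hee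
      obtain ⟨he, hl, hz⟩ := Finset.mem_filter.1 he
      obtain ⟨he', hl', hz'⟩ := Finset.mem_filter.1 he'
      have hP := (mem_crossingPairs.1 he).1
      have hP' := (mem_crossingPairs.1 he').1
      refine Prod.ext (crossingPairs_fst_eq he he' hl.1.le hl'.1.le ?_)
        (crossingPairs_snd_eq he he' hl.1.le hl'.1.le ?_)
      · linarith [hclose j _ hP.1 _ hP'.1 (hz.trans hz'.symm), hρ j]
      · linarith [hclose j _ hP.2 _ hP'.2 hee, hρ j]
    rw [← Finset.card_image_of_injOn hinj]
    refine hC (ρ j) (hρ j) z _ ?_ ?_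
    · intro u hu
      obtain ⟨e, he, rfl⟩ := Finset.mem_image.1 hu
      obtain ⟨he, hl, hz⟩ := Finset.mem_filter.1 he
      have hP := (mem_crossingPairs.1 he).1
      rw [← hz, dist_comm]
      exact (hnet j _ hP.1 _ hP.2 hl.2).le
    · intro u hu v hv huv
      obtain ⟨e, he, rfl⟩ := Finset.mem_image.1 hu
      obtain ⟨e', he', rfl⟩ := Finset.mem_image.1 hv
      have hP := (mem_crossingPairs.1 (Finset.mem_filter.1 he).1).1
      have hP' := (mem_crossingPairs.1 (Finset.mem_filter.1 he').1).1
      exact hsep (j + 5) _ (hνN _ _ hP.2) _ (hνN _ _ hP'.2) huv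
  have hF₂ : ∀ z j, (F₂ z j).card ≤ C := by
    intro z j
    have hinj : Set.InjOn (fun e : Pt d × Pt d => ν (j + 5) e.1) (F₂ z j) := by
      intro e he e' he' hee
      obtain ⟨he, hl, hz⟩ := Finset.mem_filter.1 he
      obtain ⟨he', hl', hz'⟩ := Finset.mem_filter.1 he'
      have hP := (mem_crossingPairs.1 he).1
      have hP' := (mem_crossingPairs.1 he').1
      refine Prod.ext (crossingPairs_fst_eq he he' hl.1.le hl'.1.le ?_)
        (crossingPairs_snd_eq he he' hl.1.le hl'.1.le ?_)
      · linarith [hclose j _ hP.1 _ hP'.1 hee, hρ j]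
      · linarith [hclose j _ hP.2 _ hP'.2 (hz.trans hz'.symm), hρ j]
    rw [← Finset.card_image_of_injOn hinj]
    refine hC (ρ j) (hρ j) z _ ?_ ?_
    · intro u hu
      obtain ⟨e, he, rfl⟩ := Finset.mem_image.1 hu
      obtain ⟨he, hl, hz⟩ := Finset.mem_filter.1 he
      have hP := (mem_crossingPairs.1 he).1
      rw [← hz]
      exact (hnet j _ hP.1 _ hP.2 hl.2).le
    · intro u hu v hv huv
      obtain ⟨e, he, rfl⟩ := Finset.mem_image.1 hu
      obtain ⟨e', he', rfl⟩ := Finset.mem_image.1 hv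
      have hP := (mem_crossingPairs.1 (Finset.mem_filter.1 he).1).1
      have hP' := (mem_crossingPairs.1 (Finset.mem_filter.1 he').1).1
      exact hsep (j + 5) _ (hνN _ _ hP.1) _ (hνN _ _ hP'.1) huv
  -- a point of the net at scale `j + 5` but not at scale `j` has entered just in between
  have hκ : ∀ z j, z ∈ N (j + 5) → z ∉ N j → ∃ i ∈ Finset.range 5, j = κ z - 1 - i := by
    intro z j h5 h0
    have h1 : κ z ≤ j + 5 := Nat.sInf_le h5
    have h2 : z ∈ N (κ z) := Nat.sInf_mem (s := {k | z ∈ N k}) ⟨_, h5⟩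
    have h3 : j < κ z := by
      by_contra! hle
      exact h0 (hmono hle h2)
    exact ⟨κ z - 1 - j, by simp only [Finset.mem_range]; omega, by omega⟩
  have hsub : crossingPairs P h ⊆ P.biUnion fun z => (Finset.range 5).biUnion fun i =>
      F₁ z (κ z - 1 - i) ∪ F₂ z (κ z - 1 - i) := by
    intro e he
    obtain ⟨⟨hp, hq⟩, hlt, hgt, -⟩ := mem_crossingPairs.1 he
    have hne : e.1 ≠ e.2 := fun heq => by rw [heq] at hlt; linarith
    have hpos : 0 < dist e.1 e.2 := dist_pos.2 hne
    obtain ⟨j, hj1, hj2⟩ : ∃ j, 8 * ρ j < dist e.1 e.2 ∧ dist e.1 e.2 ≤ 16 * ρ j := by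
      have hle : dist e.1 e.2 / (R / 2) ≤ 1 := by
        rw [div_le_one (by positivity)]
        linarith [hD _ hp _ hq, le_abs_self D]
      obtain ⟨j, h1, h2⟩ := exists_nat_pow_near_of_lt_one (div_pos hpos (half_pos hR)) hle
        (show (0 : ℝ) < 1 / 2 by norm_num) (by norm_num)
      rw [lt_div_iff₀ (half_pos hR)] at h1
      rw [div_le_iff₀ (half_pos hR)] at h2
      have h3 : ((1 : ℝ) / 2) ^ j * (R / 2) = 16 * ρ j := by
        simp only [ρ, pow_add, one_div, inv_pow]; field_simp; norm_num
      refine ⟨j, ?_, by linarith⟩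
      rw [pow_succ] at h1
      linarith
    have hcase : ν (j + 5) e.1 ∉ N j ∨ ν (j + 5) e.2 ∉ N j := by
      by_contra! hboth
      have hne' : ν (j + 5) e.1 ≠ ν (j + 5) e.2 := fun heq => by
        linarith [hclose j _ hp _ hq heq, hρ j]
      have h1 := hsep j _ hboth.1 _ hboth.2 hne'
      rw [hρ5] at h1
      linarith [hnet j _ hp _ hq hj2, hρ j]
    simp only [Finset.mem_biUnion, Finset.mem_union]
    rcases hcase with hz | hz
    · obtain ⟨i, hi, hji⟩ := hκ _ j (hνN _ _ hp) hz
      refine ⟨_, hNP _ (hνN (j + 5) _ hp), i, hi, Or.inl ?_⟩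
      rw [← hji]
      exact Finset.mem_filter.2 ⟨he, ⟨hj1, hj2⟩, rfl⟩
    · obtain ⟨i, hi, hji⟩ := hκ _ j (hνN _ _ hq) hz
      refine ⟨_, hNP _ (hνN (j + 5) _ hq), i, hi, Or.inr ?_⟩
      rw [← hji]
      exact Finset.mem_filter.2 ⟨he, ⟨hj1, hj2⟩, rfl⟩
  calc (crossingPairs P h).card
      ≤ P.card * (5 * (C + C)) := by
        refine (Finset.card_le_card hsub).trans (Finset.card_biUnion_le_card_mul _ _ _ ?_)
        intro z _
        have := Finset.card_biUnion_le_card_mul (Finset.range 5)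
          (fun i => F₁ z (κ z - 1 - i) ∪ F₂ z (κ z - 1 - i)) (C + C) (fun i _ =>
            (Finset.card_union_le _ _).trans (add_le_add (hF₁ _ _) (hF₂ _ _)))
        simpa using this
    _ = 5 * (C + C) * P.card := mul_comm _ _

/-! ### The upper bound: divide and conquer over the hyperplanes -/

theorem CP_eq_coe_iff {d : ℕ} [NeZero d] {S : Finset (Pt d)} (hS : GeneralPosition S) {a b : ℝ}
    {e : Sym2 (Pt d)} :
    CP S a b = (e : WithTop (Sym2 (Pt d))) ↔ IsClosestPair (slab d a b ∩ (S : Set (Pt d))) e := by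
  classical
  unfold CP
  split_ifs with h
  · rw [WithTop.coe_inj]
    exact ⟨fun he => he ▸ h.choose_spec,
      fun he => IsClosestPair.unique hS Set.inter_subset_right h.choose_spec he⟩
  · exact ⟨fun h' => absurd h' (WithTop.top_ne_coe), fun he => absurd ⟨e, he⟩ h⟩

theorem CP_eq_top_iff {d : ℕ} [NeZero d] {S : Finset (Pt d)} {a b : ℝ} :
    CP S a b = ⊤ ↔ ¬ ∃ e, IsClosestPair (slab d a b ∩ (S : Set (Pt d))) e := by
  classical
  unfold CP
  split_ifs with h
  · exact ⟨fun h' => absurd h' (WithTop.coe_ne_top), fun he => absurd h he⟩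
  · simp [h]

theorem slab_subset_slab {d : ℕ} [NeZero d] {a b a' b' : ℝ} (ha : a ≤ a') (hb : b' ≤ b) :
    slab d a' b' ⊆ slab d a b := fun _ hx => ⟨ha.trans hx.1, hx.2.trans hb⟩

theorem IsClosestPair.mono {d : ℕ} {T T' : Set (Pt d)} (hT : T' ⊆ T) {p q : Pt d}
    (h : IsClosestPair T s(p, q)) (hp : p ∈ T') (hq : q ∈ T') : IsClosestPair T' s(p, q) := by
  obtain ⟨p₁, -, q₁, -, hne, he, hmin⟩ := h
  have hd : dist p q = dist p₁ q₁ := by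
    rcases Sym2.eq_iff.1 he with ⟨rfl, rfl⟩ | ⟨rfl, rfl⟩
    · rfl
    · exact dist_comm _ _
  have hpq : p ≠ q := by
    rw [← dist_pos, hd]
    exact dist_pos.2 hne
  exact ⟨p, hp, q, hq, hpq, rfl, fun p' hp' q' hq' h' => hd ▸ hmin p' (hT hp') q' (hT hq') h'⟩

/-- The closest pair of a slab that is cut by a hyperplane is the closest pair of one of the two
parts, unless its points lie strictly on the two sides of the hyperplane. -/
theorem CP_split {d : ℕ} [NeZero d] {S : Finset (Pt d)} (hS : GeneralPosition S) {a b c : ℝ}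
    (hab : a ≤ b) (hbc : b ≤ c) :
    CP S a c = CP S a b ∨ CP S a c = CP S b c ∨
      ∃ p q : Pt d, CP S a c = (s(p, q) : Sym2 (Pt d)) ∧ p ∈ S ∧ q ∈ S ∧ a ≤ p 0 ∧ p 0 < b ∧
        b < q 0 ∧ q 0 ≤ c ∧ ∀ p' ∈ S, ∀ q' ∈ S, p' ∈ slab d (p 0) (q 0) →
          q' ∈ slab d (p 0) (q 0) → p' ≠ q' → dist p q ≤ dist p' q' := by
  rcases h : CP S a c with _ | e
  · left
    have h' := CP_eq_top_iff.1 h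
    refine (CP_eq_top_iff.2 ?_).symm
    have hfin : ∀ x y : ℝ, (slab d x y ∩ (S : Set (Pt d))).Finite := fun x y =>
      S.finite_toSet.inter_of_right _
    rw [exists_isClosestPair_iff (hfin _ _)] at h' ⊢
    exact fun hn => h' (hn.mono (Set.inter_subset_inter_left _ (slab_subset_slab le_rfl hbc)))
  · have he := (CP_eq_coe_iff hS).1 h
    have he0 := he
    obtain ⟨p, ⟨hp, hpS⟩, q, ⟨hq, hqS⟩, hne, rfl, hmin⟩ := he
    have cross : ∀ p q : Pt d, a ≤ p 0 → q 0 ≤ c →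
        (∀ p' ∈ slab d a c ∩ (S : Set (Pt d)), ∀ q' ∈ slab d a c ∩ (S : Set (Pt d)),
          p' ≠ q' → dist p q ≤ dist p' q') → ∀ p' ∈ S, ∀ q' ∈ S, p' ∈ slab d (p 0) (q 0) →
          q' ∈ slab d (p 0) (q 0) → p' ≠ q' → dist p q ≤ dist p' q' := by
      intro p q hap hqc hmin p' hp' q' hq' hps hqs hn
      exact hmin p' ⟨slab_subset_slab hap hqc hps, hp'⟩ q' ⟨slab_subset_slab hap hqc hqs, hq'⟩ hn
    have low : p 0 ≤ b → q 0 ≤ b → (↑(s(p, q) : Sym2 (Pt d)) : WithTop _) = CP S a b :=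
      fun h1 h2 => ((CP_eq_coe_iff hS).2 (he0.mono
        (Set.inter_subset_inter_left _ (slab_subset_slab le_rfl hbc))
        ⟨⟨hp.1, h1⟩, hpS⟩ ⟨⟨hq.1, h2⟩, hqS⟩)).symm
    have high : b ≤ p 0 → b ≤ q 0 → (↑(s(p, q) : Sym2 (Pt d)) : WithTop _) = CP S b c :=
      fun h1 h2 => ((CP_eq_coe_iff hS).2 (he0.mono
        (Set.inter_subset_inter_left _ (slab_subset_slab hab le_rfl))
        ⟨⟨h1, hp.2⟩, hpS⟩ ⟨⟨h2, hq.2⟩, hqS⟩)).symm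
    rcases le_or_gt (p 0) b with h1 | h1 <;> rcases le_or_gt (q 0) b with h2 | h2
    · exact Or.inl (low h1 h2)
    · rcases h1.eq_or_lt with h1' | h1'
      · exact Or.inr (Or.inl (high h1'.ge h2.le))
      · exact Or.inr (Or.inr ⟨p, q, rfl, hpS, hqS, hp.1, h1', h2, hq.2,
          cross p q hp.1 hq.2 hmin⟩)
    · rcases h2.eq_or_lt with h2' | h2'
      · exact Or.inr (Or.inl (high h1.le h2'.ge))
      · refine Or.inr (Or.inr ⟨q, p, by rw [Sym2.eq_swap]; rfl, hqS, hpS, hq.1, h2', h1, hp.2,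
          cross q p hq.1 hp.2 ?_⟩)
        rw [dist_comm q p]
        exact hmin
    · exact Or.inr (Or.inl (high h1.le h2.le))

/-- No point lies on a hyperplane, because the open slabs already contain `m * (n / m)` points. -/
theorem Admissible.exists_mem_openSlab {d : ℕ} [NeZero d] {n m : ℕ} {S : Finset (Pt d)}
    {a : Fin (m + 1) → ℝ} (h : Admissible n m S a) (hmn : m ∣ n) {p : Pt d} (hp : p ∈ S) :
    ∃ i : Fin m, p ∈ openSlab d (a i.castSucc) (a i.succ) := by
  classical
  let U : Fin m → Finset (Pt d) := fun i => {x ∈ S | x ∈ openSlab d (a i.castSucc) (a i.succ)}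
  have hU : ∀ i, (U i).card = n / m := fun i => by
    rw [← h.card_between i, ← Set.ncard_coe_finset]
    congr 1
    ext x
    simp [U]
  have hdisj : ∀ i j : Fin m, i < j → Disjoint (U i) (U j) := by
    intro i j hij
    rw [Finset.disjoint_left]
    intro x hx hx'
    have h1 := (Finset.mem_filter.1 hx).2.2
    have h2 := (Finset.mem_filter.1 hx').2.1
    have h3 : a i.succ ≤ a j.castSucc := h.strictMono.monotone (by
      rw [Fin.le_def]; simp; omega)
    linarith
  have hcard : (Finset.univ.biUnion U).card = S.card := by
    rw [Finset.card_biUnion, h.card_eq]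
    · simp [hU, Nat.mul_div_cancel' hmn]
    · intro i _ j _ hij
      rcases lt_or_gt_of_ne hij with hlt | hlt
      · exact hdisj i j hlt
      · exact (hdisj j i hlt).symm
  have hsub : Finset.univ.biUnion U ⊆ S := by
    intro x hx
    obtain ⟨i, -, hi⟩ := Finset.mem_biUnion.1 hx
    exact (Finset.mem_filter.1 hi).1
  rw [← Finset.eq_of_subset_of_card_le hsub hcard.ge] at hp
  obtain ⟨i, -, hi⟩ := Finset.mem_biUnion.1 hp
  exact ⟨i, (Finset.mem_filter.1 hi).2⟩

/-- The closest pairs over the slabs bounded by two of the hyperplanes with indices from `lo` to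
`hi`. Indices beyond `m` are allowed and contribute nothing. -/
def closestPairsBetween {d : ℕ} [NeZero d] (S : Finset (Pt d)) {m : ℕ} (a : Fin (m + 1) → ℝ)
    (lo hi : ℕ) : Set (WithTop (Sym2 (Pt d))) :=
  {x | ∃ i j : Fin (m + 1), i < j ∧ lo ≤ (i : ℕ) ∧ (j : ℕ) ≤ hi ∧ x = CP S (a i) (a j)}

theorem closestPairsBetween_finite {d : ℕ} [NeZero d] (S : Finset (Pt d)) {m : ℕ}
    (a : Fin (m + 1) → ℝ) (lo hi : ℕ) : (closestPairsBetween S a lo hi).Finite := by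
  refine (Set.finite_range fun z : Fin (m + 1) × Fin (m + 1) => CP S (a z.1) (a z.2)).subset ?_
  rintro x ⟨i, j, -, -, -, rfl⟩
  exact ⟨(i, j), rfl⟩

theorem ncard_closestPairsBetween_le_sq {d : ℕ} [NeZero d] (S : Finset (Pt d)) {m : ℕ}
    (a : Fin (m + 1) → ℝ) (lo w : ℕ) : (closestPairsBetween S a lo (lo + w)).ncard ≤ w ^ 2 := by
  classical
  let g : ℕ × ℕ → WithTop (Sym2 (Pt d)) := fun z =>
    if h : lo + z.1 < m + 1 ∧ lo + z.2 + 1 < m + 1 then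
      CP S (a ⟨lo + z.1, h.1⟩) (a ⟨lo + z.2 + 1, h.2⟩) else ⊤
  have hsub : closestPairsBetween S a lo (lo + w) ⊆
      ((Finset.range w ×ˢ Finset.range w).image g : Set (WithTop (Sym2 (Pt d)))) := by
    rintro x ⟨i, j, hij, hi, hj, rfl⟩
    have hij' : (i : ℕ) < j := hij
    rw [Finset.coe_image]
    refine ⟨((i : ℕ) - lo, (j : ℕ) - 1 - lo), ?_, ?_⟩
    · simp; omega
    · have h1 : lo + ((i : ℕ) - lo) = i := by omega
      have h2 : lo + ((j : ℕ) - 1 - lo) + 1 = j := by omega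
      have h3 : lo + ((i : ℕ) - lo) < m + 1 ∧ lo + ((j : ℕ) - 1 - lo) + 1 < m + 1 :=
        ⟨by omega, by omega⟩
      simp only [g, dif_pos h3, h1, h2, Fin.eta]
  calc (closestPairsBetween S a lo (lo + w)).ncard
      ≤ (((Finset.range w ×ˢ Finset.range w).image g : Finset _) : Set _).ncard :=
        Set.ncard_le_ncard hsub (Finset.finite_toSet _)
    _ ≤ w ^ 2 := by
        rw [Set.ncard_coe_finset]
        exact Finset.card_image_le.trans (by simp [sq])

/-- Dividing at the hyperplane with index `mid` loses only the pairs that cross it. -/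
theorem ncard_closestPairsBetween_split {d : ℕ} [NeZero d] {C : ℕ}
    (hC : ∀ (P : Finset (Pt d)) (h : ℝ), (crossingPairs P h).card ≤ C * P.card)
    {n m : ℕ} {S : Finset (Pt d)} {a : Fin (m + 1) → ℝ} (h : Admissible n m S a) (hmn : m ∣ n)
    (lo mid hi : ℕ) :
    (closestPairsBetween S a lo hi).ncard ≤ (closestPairsBetween S a lo mid).ncard +
      (closestPairsBetween S a mid hi).ncard + C * ((hi - lo) * (n / m)) := by
  classical
  by_cases hmid : m < mid
  · have hsub : closestPairsBetween S a lo hi ⊆ closestPairsBetween S a lo mid := by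
      rintro x ⟨i, j, hij, hi, hj, rfl⟩
      exact ⟨i, j, hij, hi, by omega, rfl⟩
    have := Set.ncard_le_ncard hsub (closestPairsBetween_finite _ _ _ _)
    omega
  set c : Fin (m + 1) := ⟨mid, by omega⟩ with hc
  let I : Finset (Fin m) := {i | lo ≤ (i : ℕ) ∧ (i : ℕ) < hi}
  let P : Finset (Pt d) :=
    I.biUnion fun i => {x ∈ S | x ∈ openSlab d (a i.castSucc) (a i.succ)}
  have hI : I.card ≤ hi - lo := by
    rw [← Nat.card_Ico]
    refine Finset.card_le_card_of_injOn (fun i => (i : ℕ)) ?_ (Fin.val_injective.injOn)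
    intro i hi'
    have := (Finset.mem_filter.1 hi').2
    simpa using this
  have hPcard : P.card ≤ (hi - lo) * (n / m) := by
    refine (Finset.card_biUnion_le_card_mul _ _ (n / m) fun i _ => ?_).trans
      (Nat.mul_le_mul_right _ hI)
    rw [← h.card_between i, ← Set.ncard_coe_finset]
    apply le_of_eq
    congr 1
    ext x
    simp
  have hPS : P ⊆ S := by
    intro x hx
    obtain ⟨i, -, hi⟩ := Finset.mem_biUnion.1 hx
    exact (Finset.mem_filter.1 hi).1
  have hP : ∀ i j : Fin (m + 1), lo ≤ (i : ℕ) → (j : ℕ) ≤ hi → ∀ p ∈ S, a i ≤ p 0 → p 0 ≤ a j →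
      p ∈ P := by
    intro i j hi hj p hp hip hpj
    obtain ⟨k, hk⟩ := h.exists_mem_openSlab hmn hp
    have h3 : i < k.succ := h.strictMono.lt_iff_lt.1 (hip.trans_lt hk.2)
    have h4 : k.castSucc < j := h.strictMono.lt_iff_lt.1 (hk.1.trans_le hpj)
    rw [Fin.lt_def] at h3 h4
    simp only [Fin.val_succ, Fin.val_castSucc] at h3 h4
    exact Finset.mem_biUnion.2 ⟨k, Finset.mem_filter.2 ⟨Finset.mem_univ _, by omega, by omega⟩,
      Finset.mem_filter.2 ⟨hp, hk⟩⟩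
  let X : Finset (WithTop (Sym2 (Pt d))) :=
    (crossingPairs P (a c)).image fun e => ((s(e.1, e.2) : Sym2 (Pt d)) : WithTop (Sym2 (Pt d)))
  have hX : X.card ≤ C * ((hi - lo) * (n / m)) :=
    Finset.card_image_le.trans ((hC P _).trans (Nat.mul_le_mul_left _ hPcard))
  have hsub : closestPairsBetween S a lo hi ⊆
      (closestPairsBetween S a lo mid ∪ closestPairsBetween S a mid hi) ∪ (X : Set _) := by
    rintro x ⟨i, j, hij, hi', hj', rfl⟩
    have hij' : (i : ℕ) < j := hij
    by_cases hjm : (j : ℕ) ≤ mid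
    · exact Or.inl (Or.inl ⟨i, j, hij, hi', hjm, rfl⟩)
    by_cases him : mid ≤ (i : ℕ)
    · exact Or.inl (Or.inr ⟨i, j, hij, him, hj', rfl⟩)
    have hic : i < c := by rw [Fin.lt_def]; simp [hc]; omega
    have hcj : c < j := by rw [Fin.lt_def]; simp [hc]; omega
    rcases CP_split h.generalPosition (h.strictMono hic).le (h.strictMono hcj).le with
      heq | heq | ⟨p, q, heq, hp, hq, hp1, hp2, hq1, hq2, hmin⟩
    · exact Or.inl (Or.inl ⟨i, c, hic, hi', le_rfl, heq⟩)
    · exact Or.inl (Or.inr ⟨c, j, hcj, le_rfl, hj', heq⟩)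
    · refine Or.inr (Finset.mem_coe.2 (Finset.mem_image.2 ⟨(p, q), ?_, heq.symm⟩))
      have hcj' := h.strictMono hcj
      have hic' := h.strictMono hic
      exact mem_crossingPairs.2 ⟨⟨hP i j hi' hj' p hp hp1 (by linarith),
        hP i j hi' hj' q hq (by linarith) hq2⟩, hp2, hq1,
        fun p' hp' q' hq' => hmin p' (hPS hp') q' (hPS hq')⟩
  calc _ ≤ ((closestPairsBetween S a lo mid ∪ closestPairsBetween S a mid hi) ∪
        (X : Set (WithTop (Sym2 (Pt d))))).ncard :=
        Set.ncard_le_ncard hsub (((closestPairsBetween_finite _ _ _ _).union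
          (closestPairsBetween_finite _ _ _ _)).union (Finset.finite_toSet _))
    _ ≤ _ := by
        refine (Set.ncard_union_le _ _).trans (add_le_add (Set.ncard_union_le _ _) ?_)
        rwa [Set.ncard_coe_finset]

/-- The recursion stops at `2 ^ e ≤ n / m` hyperplanes, where counting slabs is good enough; above,
each of the `t` levels of the recursion costs linearly many crossing pairs. -/
theorem ncard_closestPairsBetween_le {d : ℕ} [NeZero d] {C : ℕ}
    (hC : ∀ (P : Finset (Pt d)) (h : ℝ), (crossingPairs P h).card ≤ C * P.card)
    {n m : ℕ} {S : Finset (Pt d)} {a : Fin (m + 1) → ℝ} (h : Admissible n m S a) (hmn : m ∣ n)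
    {e : ℕ} (he : 2 ^ e ≤ n / m) (t lo : ℕ) :
    (closestPairsBetween S a lo (lo + 2 ^ (e + t))).ncard ≤
      2 ^ (e + t) * (n / m) * (1 + C * t) := by
  induction t generalizing lo with
  | zero =>
    refine (ncard_closestPairsBetween_le_sq S a lo _).trans ?_
    simp only [add_zero, mul_zero, mul_one, sq]
    gcongr
  | succ t ih =>
    have hpow : 2 ^ (e + (t + 1)) = 2 ^ (e + t) + 2 ^ (e + t) := by rw [← add_assoc, pow_succ]; ring
    have h1 := ih lo
    have h2 := ih (lo + 2 ^ (e + t))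
    rw [hpow]
    generalize 2 ^ (e + t) = w at h1 h2
    have h3 := ncard_closestPairsBetween_split hC h hmn lo (lo + w) (lo + (w + w))
    rw [Nat.add_sub_cancel_left] at h3
    rw [add_assoc] at h2
    refine h3.trans ((Nat.add_le_add_right (add_le_add h1 h2) _).trans (le_of_eq ?_))
    ring

theorem A_subset_closestPairsBetween {d : ℕ} [NeZero d] (S : Finset (Pt d)) {m : ℕ}
    (a : Fin (m + 1) → ℝ) {w : ℕ} (hw : m ≤ w) : A S a ⊆ closestPairsBetween S a 0 (0 + w) := by
  rintro x ⟨i, j, hij, rfl⟩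
  exact ⟨i, j, hij, Nat.zero_le _, by omega, rfl⟩

theorem f_le {d : ℕ} [NeZero d] {n m B : ℕ}
    (h : ∀ (S : Finset (Pt d)) (a : Fin (m + 1) → ℝ), Admissible n m S a → (A S a).ncard ≤ B) :
    f d n m ≤ B := by
  rcases (counts d n m).eq_empty_or_nonempty with he | hne
  · simp [f, he]
  · refine csSup_le hne ?_
    rintro k ⟨S, a, hS, rfl⟩
    exact h S a hS

theorem le_f {d : ℕ} [NeZero d] {n m : ℕ} {S : Finset (Pt d)} {a : Fin (m + 1) → ℝ}
    (h : Admissible n m S a) : (A S a).ncard ≤ f d n m :=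
  le_csSup (bddAbove_counts d n m) ⟨S, a, h, rfl⟩

theorem f_le_sq (d : ℕ) [NeZero d] (n m : ℕ) : f d n m ≤ m ^ 2 :=
  f_le fun S a _ => (Set.ncard_le_ncard (A_subset_closestPairsBetween S a le_rfl)
    (closestPairsBetween_finite _ _ _ _)).trans (ncard_closestPairsBetween_le_sq S a 0 m)

theorem exists_f_le (d : ℕ) [NeZero d] : ∃ C : ℕ, ∀ n m e t : ℕ, m ∣ n → 2 ^ e ≤ n / m →
    m ≤ 2 ^ (e + t) → f d n m ≤ 2 ^ (e + t) * (n / m) * (1 + C * t) := by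
  obtain ⟨C, hC⟩ := exists_card_crossingPairs_le d
  refine ⟨C, fun n m e t hmn he hm => f_le fun S a h => ?_⟩
  exact (Set.ncard_le_ncard (A_subset_closestPairsBetween S a hm)
    (closestPairsBetween_finite _ _ _ _)).trans (ncard_closestPairsBetween_le hC h hmn he t 0)

/-! ### The folded sequence -/

/-- The sequence behind the lower bound, a perturbed reflected Gray code on `{0, ..., 2 ^ L - 1}`.
The second half repeats the first half backwards, up to perturbations that are small compared with
all previous distances and get smaller away from the middle. The second argument is meaningful only
below `2 ^ L`. -/
def foldSeq : ℕ → ℕ → ℤ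
  | 0, _ => 0
  | L + 1, i =>
    if i < 2 ^ L then 2 ^ (L + 2) * foldSeq L i
    else 2 ^ (L + 2) * foldSeq L (2 ^ (L + 1) - 1 - i) + ((2 ^ (L + 1) : ℤ) - i)

theorem foldSeq_succ_of_lt {L i : ℕ} (h : i < 2 ^ L) :
    foldSeq (L + 1) i = 2 ^ (L + 2) * foldSeq L i := by
  simp [foldSeq, h]

theorem foldSeq_succ_of_ge {L i : ℕ} (h : 2 ^ L ≤ i) :
    foldSeq (L + 1) i =
      2 ^ (L + 2) * foldSeq L (2 ^ (L + 1) - 1 - i) + ((2 ^ (L + 1) : ℤ) - i) := by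
  simp [foldSeq, not_lt.2 h]

theorem lt_abs_mul_add {M x δ : ℤ} {c : ℤ} (hM : 0 ≤ M) (hx : x ≠ 0) (h : c + |δ| < M) :
    c < |M * x + δ| := by
  have h1 : M ≤ |M * x| := by
    rw [abs_mul, abs_of_nonneg hM]
    exact le_mul_of_one_le_right hM (Int.one_le_abs hx)
  have h2 := abs_sub_abs_le_abs_sub (M * x) (-δ)
  rw [abs_neg, sub_neg_eq_add] at h2
  linarith

theorem abs_mul_add_lt_abs_mul_add {M x y δ δ' : ℤ} (hM : 0 ≤ M) (hxy : |x| < |y|)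
    (h : |δ| + |δ'| < M) : |M * x + δ| < |M * y + δ'| := by
  have h1 : |M * x| + M ≤ |M * y| := by
    rw [abs_mul, abs_mul, abs_of_nonneg hM]
    nlinarith
  have h2 := abs_sub_abs_le_abs_sub (M * y) (-δ')
  rw [abs_neg, sub_neg_eq_add] at h2
  linarith [abs_add_le (M * x) δ]

theorem foldSeq_injOn (L : ℕ) : Set.InjOn (foldSeq L) {i | i < 2 ^ L} := by
  induction L with
  | zero =>
    intro i hi j hj _
    simp at hi hj
    omega
  | succ L ih =>
    have key : ∀ x y : ℕ, x < 2 ^ L → 2 ^ L ≤ y → y < 2 ^ (L + 1) →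
        foldSeq (L + 1) x ≠ foldSeq (L + 1) y := by
      intro x y hx hy hy' heq
      rw [foldSeq_succ_of_lt hx, foldSeq_succ_of_ge hy] at heq
      have h1 : (2 ^ (L + 2) : ℤ) ∣ (2 ^ (L + 1) : ℤ) - y :=
        ⟨foldSeq L x - foldSeq L (2 ^ (L + 1) - 1 - y), by linear_combination -heq⟩
      have hy2 : (y : ℤ) < 2 ^ (L + 1) := by exact_mod_cast hy'
      have h2 := Int.le_of_dvd (by linarith) h1
      rw [pow_succ (2 : ℤ) (L + 1)] at h2
      have : (0 : ℤ) < 2 ^ (L + 1) := by positivity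
      have : (0 : ℤ) ≤ y := by positivity
      linarith
    intro i hi j hj hij
    simp only [Set.mem_ofPred_eq] at hi hj
    have hpow : 2 ^ (L + 1) = 2 * 2 ^ L := pow_succ' 2 L
    have hpowZ : (2 : ℤ) ^ (L + 1) = 2 * 2 ^ L := pow_succ' 2 L
    have hM : (2 : ℤ) ^ (L + 2) ≠ 0 := by positivity
    rcases lt_or_ge i (2 ^ L) with hi' | hi' <;> rcases lt_or_ge j (2 ^ L) with hj' | hj'
    · rw [foldSeq_succ_of_lt hi', foldSeq_succ_of_lt hj'] at hij
      exact ih hi' hj' (mul_left_cancel₀ hM hij)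
    · exact absurd hij (key i j hi' hj' hj)
    · exact absurd hij.symm (key j i hj' hi' hi)
    · by_contra hne
      have hne' : foldSeq L (2 ^ (L + 1) - 1 - i) - foldSeq L (2 ^ (L + 1) - 1 - j) ≠ 0 := by
        rw [sub_ne_zero]
        intro heq
        have := ih (show 2 ^ (L + 1) - 1 - i < 2 ^ L by omega)
          (show 2 ^ (L + 1) - 1 - j < 2 ^ L by omega) heq
        omega
      rw [foldSeq_succ_of_ge hi', foldSeq_succ_of_ge hj'] at hij
      have h1 := lt_abs_mul_add (c := 0) (M := 2 ^ (L + 2)) (δ := (j : ℤ) - i) (by positivity) hne'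
        (by
          rw [zero_add, abs_lt, pow_succ, hpowZ]
          zify at hi hj
          constructor <;> linarith [show (0 : ℤ) ≤ i by positivity, show (0 : ℤ) ≤ j by positivity])
      rw [abs_pos] at h1
      exact h1 (by linear_combination hij)

/-- The separation property of the folded sequence. In a dyadic block, starting at `b` and of length
`2 ^ (l + 1)`, the two terms at distance `r` from the middle are closer to each other than any two
terms of the block with a smaller difference of indices. -/
theorem abs_foldSeq_sub_lt (L : ℕ) {l b r p q : ℕ} (hb : 2 ^ (l + 1) ∣ b)
    (hbL : b + 2 ^ (l + 1) ≤ 2 ^ L) (hr : r < 2 ^ l) (hpq : p < q) (hbp : b ≤ p)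
    (hqb : q < b + 2 ^ (l + 1)) (hqp : q ≤ p + 2 * r) :
    |foldSeq L (b + 2 ^ l - 1 - r) - foldSeq L (b + 2 ^ l + r)| <
      |foldSeq L p - foldSeq L q| := by
  induction L generalizing b p q with
  | zero =>
    have : 1 ≤ 2 ^ l := Nat.one_le_two_pow
    rw [pow_succ, pow_zero] at hbL
    omega
  | succ L ih =>
    have hpow : 2 ^ (L + 1) = 2 * 2 ^ L := pow_succ' 2 L
    have hpowZ : (2 : ℤ) ^ (L + 1) = 2 * 2 ^ L := pow_succ' 2 L
    have hpow2Z : (2 : ℤ) ^ (L + 2) = 4 * 2 ^ L := by ring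
    have hl : 2 ^ (l + 1) = 2 * 2 ^ l := pow_succ' 2 l
    have hM : (0 : ℤ) ≤ 2 ^ (L + 2) := by positivity
    rcases lt_or_ge l L with hlL | hlL
    · obtain ⟨c, hc⟩ : 2 ^ (l + 1) ∣ 2 ^ L := pow_dvd_pow 2 hlL
      obtain ⟨k, rfl⟩ := hb
      rcases lt_or_ge k c with hkc | hkc
      · have hlow : 2 ^ (l + 1) * k + 2 ^ (l + 1) ≤ 2 ^ L := by
          rw [hc, ← Nat.mul_succ]
          exact Nat.mul_le_mul_left _ hkc
        have h1 := ih (Dvd.intro k rfl) hlow hpq hbp hqb hqp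
        rw [foldSeq_succ_of_lt (by omega), foldSeq_succ_of_lt (by omega),
          foldSeq_succ_of_lt (by omega), foldSeq_succ_of_lt (by omega), ← mul_sub, ← mul_sub,
          abs_mul, abs_mul]
        exact mul_lt_mul_of_pos_left h1 (by positivity)
      · have hhigh : 2 ^ L ≤ 2 ^ (l + 1) * k := by
          rw [hc]
          exact Nat.mul_le_mul_left _ hkc
        have hdvd : 2 ^ (l + 1) ∣ 2 ^ (L + 1) - (2 ^ (l + 1) * k + 2 ^ (l + 1)) :=
          Nat.dvd_sub (pow_dvd_pow 2 (by omega)) ⟨k + 1, by ring⟩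
        generalize 2 ^ (l + 1) * k = b at hbL hbp hqb hhigh hdvd ⊢
        have h1 := ih (b := 2 ^ (L + 1) - (b + 2 ^ (l + 1))) (p := 2 ^ (L + 1) - 1 - q)
          (q := 2 ^ (L + 1) - 1 - p) hdvd (by omega) (by omega) (by omega) (by omega) (by omega)
        rw [foldSeq_succ_of_ge (i := b + 2 ^ l - 1 - r) (by omega),
          foldSeq_succ_of_ge (i := b + 2 ^ l + r) (by omega), foldSeq_succ_of_ge (i := p) (by omega),
          foldSeq_succ_of_ge (i := q) (by omega),
          show 2 ^ (L + 1) - 1 - (b + 2 ^ l - 1 - r) =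
            2 ^ (L + 1) - (b + 2 ^ (l + 1)) + 2 ^ l + r by omega,
          show 2 ^ (L + 1) - 1 - (b + 2 ^ l + r) =
            2 ^ (L + 1) - (b + 2 ^ (l + 1)) + 2 ^ l - 1 - r by omega]
        rw [abs_sub_comm, abs_sub_comm (foldSeq L (2 ^ (L + 1) - 1 - q))] at h1
        have h2 := abs_mul_add_lt_abs_mul_add (M := 2 ^ (L + 2))
          (δ := ((b + 2 ^ l + r : ℕ) : ℤ) - ((b + 2 ^ l - 1 - r : ℕ) : ℤ)) (δ' := (q : ℤ) - p)
          hM h1 (by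
            rw [abs_of_nonneg (by omega), abs_of_nonneg (by omega)]
            zify at hhigh hbL hpow hqb hl hr
            omega)
        convert h2 using 2 <;> ring
    · -- the block is everything, and its middle is the place of the last folding
      obtain rfl : l = L := by
        refine le_antisymm ?_ hlL
        have : 2 ^ (l + 1) ≤ 2 ^ (L + 1) := by omega
        have := (Nat.pow_le_pow_iff_right (by norm_num : 1 < 2)).1 this
        omega
      obtain rfl : b = 0 := by omega
      simp only [zero_add] at *
      have hrZ : (r : ℤ) < 2 ^ l := by exact_mod_cast hr
      have hqZ : (q : ℤ) < 2 * 2 ^ l := by rw [← hpowZ]; exact_mod_cast hqb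
      have hleft : |foldSeq (l + 1) (2 ^ l - 1 - r) - foldSeq (l + 1) (2 ^ l + r)| = 2 ^ l - r := by
        rw [foldSeq_succ_of_lt (i := 2 ^ l - 1 - r) (by omega),
          foldSeq_succ_of_ge (i := 2 ^ l + r) (by omega),
          show 2 ^ (l + 1) - 1 - (2 ^ l + r) = 2 ^ l - 1 - r by omega, sub_add_cancel_left,
          abs_neg, abs_of_nonneg]
        · push_cast; linarith
        · push_cast; linarith
      rw [hleft]
      have hinj : ∀ x y : ℕ, x < 2 ^ l → y < 2 ^ l → x ≠ y → foldSeq l x - foldSeq l y ≠ 0 :=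
        fun x y hx hy hxy => sub_ne_zero.2 fun h => hxy (foldSeq_injOn l hx hy h)
      rcases lt_or_ge q (2 ^ l) with hq | hq
      · rw [foldSeq_succ_of_lt (i := p) (by omega), foldSeq_succ_of_lt hq, ← mul_sub]
        have h1 := lt_abs_mul_add (δ := 0) (c := 2 ^ l - r) hM
          (hinj p q (by omega) hq (by omega)) (by rw [abs_zero]; omega)
        rwa [add_zero] at h1
      rcases lt_or_ge p (2 ^ l) with hp | hp
      · rw [foldSeq_succ_of_lt hp, foldSeq_succ_of_ge hq]
        have hqZ' : (2 : ℤ) ^ l ≤ q := by exact_mod_cast hq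
        by_cases hsym : p = 2 ^ (l + 1) - 1 - q
        · rw [← hsym, sub_add_cancel_left, abs_neg, abs_of_nonneg (by linarith)]
          have hqr : q < 2 ^ l + r := by omega
          have hqrZ : (q : ℤ) < 2 ^ l + r := by exact_mod_cast hqr
          linarith
        · have h1 := lt_abs_mul_add (δ := q - 2 ^ (l + 1)) (c := 2 ^ l - r) hM
            (hinj p (2 ^ (l + 1) - 1 - q) hp (by omega) hsym)
            (by
              rw [abs_of_nonpos (by linarith)]
              omega)
          convert h1 using 2
          ring
      · rw [foldSeq_succ_of_ge hp, foldSeq_succ_of_ge hq]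
        have hpZ' : (2 : ℤ) ^ l ≤ p := by exact_mod_cast hp
        have h1 := lt_abs_mul_add (δ := (q : ℤ) - p) (c := 2 ^ l - r) hM
          (hinj (2 ^ (l + 1) - 1 - p) (2 ^ (l + 1) - 1 - q) (by omega) (by omega) (by omega))
          (by
            rw [abs_of_nonneg (by omega)]
            omega)
        convert h1 using 2
        ring

/-! ### Points with prescribed comparisons of distances -/

/-- The point with the first two coordinates `x` and `y` and all others zero. -/
noncomputable def planePoint {d : ℕ} [NeZero d] (hd : 2 ≤ d) (x y : ℝ) : Pt d :=
  EuclideanSpace.single 0 x + EuclideanSpace.single ⟨1, hd⟩ y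

theorem planePoint_zero {d : ℕ} [NeZero d] (hd : 2 ≤ d) (x y : ℝ) : planePoint hd x y 0 = x := by
  have : (0 : Fin d) ≠ ⟨1, hd⟩ := fun h => by simpa using congrArg Fin.val h
  simp [planePoint, this]

theorem dist_planePoint_sq {d : ℕ} [NeZero d] (hd : 2 ≤ d) (x y x' y' : ℝ) :
    dist (planePoint hd x y) (planePoint hd x' y') ^ 2 = (x - x') ^ 2 + (y - y') ^ 2 := by
  have hne : (0 : Fin d) ≠ ⟨1, hd⟩ := fun h => by simpa using congrArg Fin.val h
  have hsub : planePoint hd x y - planePoint hd x' y' =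
      EuclideanSpace.single 0 (x - x') + EuclideanSpace.single ⟨1, hd⟩ (y - y') := by
    ext i
    simp only [planePoint, PiLp.sub_apply, PiLp.add_apply, PiLp.single_apply]
    split_ifs <;> ring
  rw [dist_eq_norm, hsub, norm_add_sq_real, PiLp.norm_single, PiLp.norm_single]
  simp [EuclideanSpace.inner_single_left, hne]

theorem eq_and_eq_of_two_pow_sub_eq {a b c e : ℕ} (hab : a < b) (hce : c < e)
    (h : (2 : ℤ) ^ b - 2 ^ a = 2 ^ e - 2 ^ c) : a = c ∧ b = e := by
  have key : ∀ a b c e : ℕ, c < e → 2 ^ b + 2 ^ c = 2 ^ e + 2 ^ a → e ≤ b := by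
    intro a b c e hce h
    by_contra! hbe
    obtain ⟨k, rfl⟩ : ∃ k, e = k + 1 := ⟨e - 1, by omega⟩
    have h1 : 2 ^ b ≤ 2 ^ k := Nat.pow_le_pow_right (by norm_num) (by omega)
    have h2 : 2 ^ c ≤ 2 ^ k := Nat.pow_le_pow_right (by norm_num) (by omega)
    have h3 : 0 < 2 ^ a := by positivity
    rw [pow_succ] at h
    omega
  have hN : 2 ^ b + 2 ^ c = 2 ^ e + 2 ^ a := by
    zify
    linarith
  have hbe : b = e := le_antisymm (key c e a b hab hN.symm) (key a b c e hce hN)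
  subst hbe
  exact ⟨(Nat.pow_right_injective le_rfl (by omega : 2 ^ c = 2 ^ a)).symm, rfl⟩

/-- Integers `Y 0, Y 1, ...` are turned into points with first coordinates `0, 1, ...`, such that
the distances of the first `n` points are ordered like the differences of the integers, and ties are
broken. The second coordinate is a large multiple of `Y a`, so that differences of first coordinates
do not matter, plus a perturbation by `2 ^ a`, since the differences of powers of two are
distinct. -/
theorem exists_points {d : ℕ} [NeZero d] (hd : 2 ≤ d) (n : ℕ) (Y : ℕ → ℤ) :
    ∃ pt : ℕ → Pt d, (∀ a, pt a 0 = a) ∧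
      (∀ a < n, ∀ b < n, ∀ c < n, ∀ e < n, |Y a - Y b| < |Y c - Y e| →
        dist (pt a) (pt b) < dist (pt c) (pt e)) ∧
      ∀ a < n, ∀ b < n, ∀ c < n, ∀ e < n, a < b → c < e →
        dist (pt a) (pt b) = dist (pt c) (pt e) → a = c ∧ b = e := by
  let y : ℕ → ℤ := fun a => 2 ^ (n + 1) * Y a + 2 ^ a
  let pt : ℕ → Pt d := fun a => planePoint hd (a : ℝ) (((n + 1 : ℕ) : ℝ) * (y a : ℝ))
  have hdist : ∀ a b, dist (pt a) (pt b) ^ 2 =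
      ((((a : ℤ) - b) ^ 2 + ((n : ℤ) + 1) ^ 2 * (y a - y b) ^ 2 : ℤ) : ℝ) := by
    intro a b
    rw [dist_planePoint_sq]
    push_cast
    ring
  have hlt : ∀ a < n, ∀ b < n, ∀ c < n, ∀ e < n, |y a - y b| < |y c - y e| →
      dist (pt a) (pt b) < dist (pt c) (pt e) := by
    intro a ha b hb c hc e he h
    refine lt_of_pow_lt_pow_left₀ 2 dist_nonneg ?_
    rw [hdist, hdist, Int.cast_lt]
    have h1 : (y a - y b) ^ 2 + 1 ≤ (y c - y e) ^ 2 := sq_lt_sq.2 h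
    have h2 : ((a : ℤ) - b) ^ 2 < ((n : ℤ) + 1) ^ 2 := by
      rw [sq_lt_sq, abs_of_nonneg (by positivity : (0 : ℤ) ≤ n + 1), abs_lt]
      constructor <;> omega
    have h3 := mul_le_mul_of_nonneg_left h1 (sq_nonneg ((n : ℤ) + 1))
    nlinarith [sq_nonneg ((c : ℤ) - e)]
  have hδ : ∀ a < n, ∀ b < n, |(2 : ℤ) ^ a - 2 ^ b| < 2 ^ n := by
    intro a ha b hb
    have h1 : (2 : ℤ) ^ a < 2 ^ n := pow_lt_pow_right₀ (by norm_num) ha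
    have h2 : (2 : ℤ) ^ b < 2 ^ n := pow_lt_pow_right₀ (by norm_num) hb
    rw [abs_lt]
    constructor <;> linarith [show (0 : ℤ) < 2 ^ a by positivity, show (0 : ℤ) < 2 ^ b by positivity]
  have hysub : ∀ a b, y a - y b = 2 ^ (n + 1) * (Y a - Y b) + (2 ^ a - 2 ^ b) := fun a b => by
    simp only [y]; ring
  refine ⟨pt, fun a => planePoint_zero hd _ _, ?_, ?_⟩
  · intro a ha b hb c hc e he h
    refine hlt a ha b hb c hc e he ?_
    rw [hysub, hysub]
    refine abs_mul_add_lt_abs_mul_add (by positivity) h ?_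
    rw [pow_succ]
    linarith [hδ a ha b hb, hδ c hc e he]
  · intro a ha b hb c hc e he hab hce h
    have habs : |y a - y b| = |y c - y e| := by
      rcases lt_trichotomy |y a - y b| |y c - y e| with h' | h' | h'
      · exact absurd h (hlt a ha b hb c hc e he h').ne
      · exact h'
      · exact absurd h (hlt c hc e he a ha b hb h').ne'
    have hpos : ∀ {x z : ℕ}, x < z → (2 : ℤ) ^ x < 2 ^ z := fun h =>
      pow_lt_pow_right₀ (by norm_num) h
    have hδ1 := abs_lt.1 (hδ a ha b hb)
    have hδ2 := abs_lt.1 (hδ c hc e he)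
    have hN : (2 : ℤ) ^ (n + 1) = 2 * 2 ^ n := pow_succ' 2 n
    rcases abs_eq_abs.1 habs with h' | h' <;> rw [hysub, hysub] at h'
    · have hz : (2 : ℤ) ^ a - 2 ^ b - (2 ^ c - 2 ^ e) = 0 :=
        Int.eq_zero_of_abs_lt_dvd (m := 2 ^ (n + 1))
          ⟨(Y c - Y e) - (Y a - Y b), by linear_combination h'⟩
          (by rw [abs_lt]; constructor <;> linarith [hδ1.1, hδ1.2, hδ2.1, hδ2.2])
      exact eq_and_eq_of_two_pow_sub_eq hab hce (by linarith)
    · have hz : (2 : ℤ) ^ a - 2 ^ b + (2 ^ c - 2 ^ e) = 0 :=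
        Int.eq_zero_of_abs_lt_dvd (m := 2 ^ (n + 1))
          ⟨-(Y c - Y e) - (Y a - Y b), by linear_combination h'⟩
          (by rw [abs_lt]; constructor <;> linarith [hδ1.1, hδ1.2, hδ2.1, hδ2.2])
      linarith [hpos hab, hpos hce]

/-! ### Slabs with different closest pairs -/

/-- The integers to which the construction is applied, in the order of first coordinates. There are
`s` consecutive indices to each strip between consecutive hyperplanes. Index `x` lies in strip
`x / s`; the points with a given residue `x % s` carry a copy of the folded sequence, shifted by
`x % s % 2 ^ e` strips, and a large factor `B` keeps the copies apart. -/
def stripSeq (L e s : ℕ) (B : ℤ) (x : ℕ) : ℤ :=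
  B * (x % s : ℕ) + foldSeq L (x / s + x % s % 2 ^ e)

/-- `IsFoldSlab m e u v` says that, for some shift `τ < 2 ^ e`, the strips `u` and `v` shifted by
`τ` are symmetric about the middle of a dyadic block of `{0, ..., m - 1}`, and stay inside the block
under all these shifts. -/
def IsFoldSlab (m e u v : ℕ) : Prop :=
  ∃ l b r τ : ℕ, 2 ^ (l + 1) ∣ b ∧ b + 2 ^ (l + 1) ≤ m ∧ r + 2 ^ e ≤ 2 ^ l ∧ τ < 2 ^ e ∧
    u + τ = b + 2 ^ l - 1 - r ∧ v + τ = b + 2 ^ l + r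

theorem IsFoldSlab.lt {m e u v : ℕ} (h : IsFoldSlab m e u v) : u < v ∧ v < m := by
  obtain ⟨l, b, r, τ, -, hbm, hr, hτ, hu, hv⟩ := h
  have : 2 ^ (l + 1) = 2 * 2 ^ l := pow_succ' 2 l
  omega

/-- If the strips `u` and `v` form a fold slab, some pair with ends in these two strips is closer
than all pairs in the slab whose ends are not in these two strips: among the pairs in one copy of
the folded sequence this is the separation property, and the copies are far apart. -/
theorem exists_abs_stripSeq_sub_lt {L e s m u v : ℕ} {B F : ℤ} (hes : 2 ^ e ≤ s) (hmL : m ≤ 2 ^ L)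
    (hF : ∀ i < 2 ^ L, |foldSeq L i| ≤ F) (hB : 4 * F < B) (h : IsFoldSlab m e u v) :
    ∃ x₀ y₀ : ℕ, x₀ / s = u ∧ y₀ / s = v ∧ ∀ x y : ℕ, x ≠ y → u ≤ x / s → x / s ≤ y / s →
      y / s ≤ v → ¬ (x / s = u ∧ y / s = v) →
        |stripSeq L e s B x₀ - stripSeq L e s B y₀| < |stripSeq L e s B x - stripSeq L e s B y| := by
  obtain ⟨l, b, r, τ, hb, hbm, hr, hτ, hu, hv⟩ := h
  have hl : 2 ^ (l + 1) = 2 * 2 ^ l := pow_succ' 2 l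
  have he : 0 < 2 ^ e := by positivity
  have hs : 0 < s := he.trans_le hes
  have hdiv : ∀ w, (w * s + τ) / s = w := fun w => by
    rw [mul_comm, Nat.mul_add_div hs, Nat.div_eq_of_lt (hτ.trans_le hes), add_zero]
  have hmod : ∀ w, (w * s + τ) % s = τ := fun w => by
    rw [mul_comm, Nat.mul_add_mod, Nat.mod_eq_of_lt (hτ.trans_le hes)]
  refine ⟨u * s + τ, v * s + τ, hdiv u, hdiv v, ?_⟩
  intro x y hxy hux hxy' hyv hne
  have hleft : stripSeq L e s B (u * s + τ) - stripSeq L e s B (v * s + τ) =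
      foldSeq L (b + 2 ^ l - 1 - r) - foldSeq L (b + 2 ^ l + r) := by
    simp only [stripSeq, hdiv, hmod, Nat.mod_eq_of_lt hτ, hu, hv]
    ring
  rw [hleft]
  have hright : stripSeq L e s B x - stripSeq L e s B y =
      B * ((x % s : ℕ) - (y % s : ℕ) : ℤ) +
        (foldSeq L (x / s + x % s % 2 ^ e) - foldSeq L (y / s + y % s % 2 ^ e)) := by
    simp only [stripSeq]
    ring
  rw [hright]
  have hxe : x % s % 2 ^ e < 2 ^ e := Nat.mod_lt _ he
  have hye : y % s % 2 ^ e < 2 ^ e := Nat.mod_lt _ he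
  by_cases hcl : x % s = y % s
  · have hlt : x / s < y / s := by
      refine lt_of_le_of_ne hxy' fun heq => hxy ?_
      rw [← Nat.div_add_mod x s, ← Nat.div_add_mod y s, heq, hcl]
    rw [hcl, sub_self, mul_zero, zero_add]
    exact abs_foldSeq_sub_lt L hb (by omega) (by omega) (by omega) (by omega) (by omega) (by omega)
  · have h2F : ∀ i < 2 ^ L, ∀ j < 2 ^ L, |foldSeq L i - foldSeq L j| ≤ 2 * F := by
      intro i hi j hj
      linarith [abs_sub (foldSeq L i) (foldSeq L j), hF i hi, hF j hj]
    have h1 := h2F (b + 2 ^ l - 1 - r) (by omega) (b + 2 ^ l + r) (by omega)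
    have h2 := h2F (x / s + x % s % 2 ^ e) (by omega) (y / s + y % s % 2 ^ e) (by omega)
    have hF0 := (abs_nonneg _).trans h1
    refine h1.trans_lt (lt_abs_mul_add (by linarith) ?_ (by linarith))
    rw [sub_ne_zero]
    exact_mod_cast hcl

/-- The configuration for the lower bound: the point with index `x` has first coordinate `x`, and the
closest pair of a slab made of the strips from `u` to `v` has its ends in the strips `u` and `v`
whenever these form a fold slab. -/
theorem exists_admissible {d : ℕ} [NeZero d] (hd : 2 ≤ d) {m s e : ℕ} (hm : 0 < m)
    (hes : 2 ^ e ≤ s) : ∃ (S : Finset (Pt d)) (a : Fin (m + 1) → ℝ) (pt : ℕ → Pt d),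
      Admissible (m * s) m S a ∧ Function.Injective pt ∧
      ∀ u v, IsFoldSlab m e u v → ∃ i j : Fin (m + 1), i < j ∧ ∃ x y, x / s = u ∧ y / s = v ∧
        CP S (a i) (a j) = (s(pt x, pt y) : Sym2 (Pt d)) := by
  classical
  have hs : 0 < s := (show 0 < 2 ^ e by positivity).trans_le hes
  obtain ⟨L, hL⟩ : ∃ L, m ≤ 2 ^ L := ⟨m, Nat.lt_two_pow_self.le⟩
  obtain ⟨F, hF⟩ : ∃ F : ℤ, ∀ i < 2 ^ L, |foldSeq L i| ≤ F :=
    ⟨∑ i ∈ Finset.range (2 ^ L), |foldSeq L i|, fun i hi =>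
      Finset.single_le_sum (f := fun i => |foldSeq L i|) (fun _ _ => abs_nonneg _)
        (Finset.mem_range.2 hi)⟩
  obtain ⟨pt, hpt0, hptlt, hpteq⟩ := exists_points hd (m * s) (stripSeq L e s (4 * F + 1))
  have hinj : Function.Injective pt := fun x y h => by
    have := congrArg (fun p : Pt d => p 0) h
    simpa [hpt0] using this
  let S : Finset (Pt d) := (Finset.range (m * s)).image pt
  have hmemS : ∀ p, p ∈ S ↔ ∃ x < m * s, pt x = p := fun p => by simp [S]
  -- the hyperplanes pass halfway between consecutive integers
  let a : Fin (m + 1) → ℝ := fun i => ((i : ℕ) * s : ℕ) - 1 / 2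
  have hlt : ∀ k x : ℕ, ((k : ℝ) - 1 / 2 < x ↔ k ≤ x) := fun k x => by
    constructor
    · intro h
      by_contra! hxk
      have : (x : ℝ) + 1 ≤ k := by exact_mod_cast hxk
      linarith
    · intro h
      have : (k : ℝ) ≤ x := by exact_mod_cast h
      linarith
  have hgt : ∀ k x : ℕ, ((x : ℝ) < (k : ℝ) - 1 / 2 ↔ x < k) := fun k x => by
    constructor
    · intro h
      have : (x : ℝ) < k := by linarith
      exact_mod_cast this
    · intro h
      have : (x : ℝ) + 1 ≤ k := by exact_mod_cast h
      linarith
  have hleft : ∀ (i : Fin (m + 1)) (x : ℕ), a i < pt x 0 ↔ (i : ℕ) ≤ x / s := fun i x => by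
    rw [hpt0, hlt, Nat.le_div_iff_mul_le hs]
  have hright : ∀ (i : Fin (m + 1)) (x : ℕ), pt x 0 < a i ↔ x / s < (i : ℕ) := fun i x => by
    rw [hpt0, hgt, Nat.div_lt_iff_lt_mul hs]
  have hmemslab : ∀ (i j : Fin (m + 1)) (x : ℕ),
      pt x ∈ slab d (a i) (a j) ↔ (i : ℕ) ≤ x / s ∧ x / s < (j : ℕ) := by
    intro i j x
    have h1 : a i ≤ pt x 0 ↔ (i : ℕ) ≤ x / s := by
      rw [← not_lt, hright, not_lt]
    have h2 : pt x 0 ≤ a j ↔ x / s < (j : ℕ) := by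
      rw [← not_lt, hleft, not_le]
    exact and_congr h1 h2
  have hgen : GeneralPosition S := by
    constructor
    · intro p hp q hq h
      obtain ⟨x, -, rfl⟩ := (hmemS p).1 hp
      obtain ⟨y, -, rfl⟩ := (hmemS q).1 hq
      rw [hpt0, hpt0] at h
      rw [Nat.cast_injective h]
    · have key : ∀ x < m * s, ∀ y < m * s, x ≠ y → ∃ x' < m * s, ∃ y' < m * s, x' < y' ∧
          s(pt x, pt y) = s(pt x', pt y') ∧ dist (pt x) (pt y) = dist (pt x') (pt y') := by
        intro x hx y hy hxy
        rcases lt_or_gt_of_ne hxy with h | h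
        · exact ⟨x, hx, y, hy, h, rfl, rfl⟩
        · exact ⟨y, hy, x, hx, h, Sym2.eq_swap, dist_comm _ _⟩
      intro p hp q hq p' hp' q' hq' hpq hpq' h
      obtain ⟨x, hx, rfl⟩ := (hmemS p).1 hp
      obtain ⟨y, hy, rfl⟩ := (hmemS q).1 hq
      obtain ⟨x', hx', rfl⟩ := (hmemS p').1 hp'
      obtain ⟨y', hy', rfl⟩ := (hmemS q').1 hq'
      obtain ⟨x₁, hx₁, y₁, hy₁, h1, h2, h3⟩ := key x hx y hy (fun h => hpq (h ▸ rfl))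
      obtain ⟨x₂, hx₂, y₂, hy₂, h1', h2', h3'⟩ := key x' hx' y' hy' (fun h => hpq' (h ▸ rfl))
      rw [h3, h3'] at h
      obtain ⟨rfl, rfl⟩ := hpteq _ hx₁ _ hy₁ _ hx₂ _ hy₂ h1 h1' h
      rw [h2, h2']
  refine ⟨S, a, pt, ⟨?_, hgen, ?_, ?_⟩, hinj, ?_⟩
  · rw [Finset.card_image_of_injective _ hinj, Finset.card_range]
  · intro i j hij
    have h1 : (i : ℕ) * s < (j : ℕ) * s := Nat.mul_lt_mul_of_pos_right hij hs
    have h2 : (((i : ℕ) * s : ℕ) : ℝ) < ((j : ℕ) * s : ℕ) := by exact_mod_cast h1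
    simp only [a]
    linarith
  · intro i
    have hset : (S : Set (Pt d)) ∩ openSlab d (a i.castSucc) (a i.succ) =
        (((Finset.Ico ((i : ℕ) * s) (((i : ℕ) + 1) * s)).image pt : Finset (Pt d)) :
          Set (Pt d)) := by
      ext p
      simp only [Set.mem_inter_iff, Finset.mem_coe, hmemS, Finset.mem_image, Finset.mem_Ico]
      constructor
      · rintro ⟨⟨x, hx, rfl⟩, h1, h2⟩
        rw [hleft, Nat.le_div_iff_mul_le hs] at h1
        rw [hright, Nat.div_lt_iff_lt_mul hs] at h2
        exact ⟨x, ⟨by simpa using h1, by simpa using h2⟩, rfl⟩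
      · rintro ⟨x, ⟨h1, h2⟩, rfl⟩
        refine ⟨⟨x, h2.trans_le (Nat.mul_le_mul_right _ i.2), rfl⟩, ?_, ?_⟩
        · rw [hleft, Nat.le_div_iff_mul_le hs]
          simpa using h1
        · rw [hright, Nat.div_lt_iff_lt_mul hs]
          simpa using h2
    rw [hset, Set.ncard_coe_finset, Finset.card_image_of_injective _ hinj, Nat.card_Ico,
      ← Nat.sub_mul, Nat.add_sub_cancel_left, one_mul, Nat.mul_div_cancel_left _ hm]
  · intro u v huv
    obtain ⟨hlt_uv, hvm⟩ := huv.lt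
    obtain ⟨x₀, y₀, hx₀, hy₀, hclose⟩ := exists_abs_stripSeq_sub_lt hes hL hF (lt_add_one _) huv
    have hbound : ∀ x, x / s ≤ v → x < m * s := fun x hx => by
      rw [← Nat.div_lt_iff_lt_mul hs]
      omega
    let i : Fin (m + 1) := ⟨u, by omega⟩
    let j : Fin (m + 1) := ⟨v + 1, by omega⟩
    have hmemT : ∀ x, u ≤ x / s → x / s ≤ v → pt x ∈ slab d (a i) (a j) ∩ (S : Set (Pt d)) :=
      fun x h1 h2 => ⟨(hmemslab i j x).2 ⟨h1, Nat.lt_succ_of_le h2⟩,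
        (hmemS _).2 ⟨x, hbound x h2, rfl⟩⟩
    have hne₀ : pt x₀ ≠ pt y₀ := fun h => by
      have := hinj h
      rw [← hx₀, ← hy₀, this] at hlt_uv
      exact lt_irrefl _ hlt_uv
    have hm₀ := hmemT x₀ (by omega) (by omega)
    have hm₁ := hmemT y₀ (by omega) (by omega)
    obtain ⟨c, hc⟩ := (exists_isClosestPair_iff (S.finite_toSet.inter_of_right
      (slab d (a i) (a j)))).2 ⟨_, hm₀, _, hm₁, hne₀⟩
    refine ⟨i, j, by rw [Fin.lt_def]; simp [i, j]; omega, ?_⟩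
    obtain ⟨p, hp, q, hq, hpq, rfl, hmin⟩ := id hc
    obtain ⟨x, -, rfl⟩ := (hmemS p).1 hp.2
    obtain ⟨y, -, rfl⟩ := (hmemS q).1 hq.2
    have hx := (hmemslab i j x).1 hp.1
    have hy := (hmemslab i j y).1 hq.1
    simp only [i, j, Nat.lt_succ_iff] at hx hy
    have hdist := hmin _ hm₀ _ hm₁ hne₀
    have hCP := (CP_eq_coe_iff hgen).2 hc
    have hends : ∀ x y : ℕ, x ≠ y → u ≤ x / s → x / s ≤ y / s → y / s ≤ v →
        dist (pt x) (pt y) ≤ dist (pt x₀) (pt y₀) → x / s = u ∧ y / s = v := by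
      intro x y hxy h1 h2 h3 h4
      by_contra hne
      exact absurd h4 (not_le.2 (hptlt _ (hbound _ (by omega)) _ (hbound _ (by omega)) _
        (hbound _ (by omega)) _ (hbound _ (by omega)) (hclose x y hxy h1 h2 h3 hne)))
    have hxy : x ≠ y := fun h => hpq (h ▸ rfl)
    rcases le_total (x / s) (y / s) with h | h
    · obtain ⟨h1, h2⟩ := hends x y hxy hx.1 h hy.2 hdist
      exact ⟨x, y, h1, h2, hCP⟩
    · rw [dist_comm] at hdist
      obtain ⟨h1, h2⟩ := hends y x hxy.symm hy.1 h hx.2 hdist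
      exact ⟨y, x, h1, h2, hCP.trans (by rw [Sym2.eq_swap])⟩

/-- Different fold slabs have different closest pairs, since a closest pair tells the slab by the
strips of its ends. -/
theorem card_le_f_of_isFoldSlab {d : ℕ} [NeZero d] (hd : 2 ≤ d) {m s e : ℕ} (hm : 0 < m)
    (hes : 2 ^ e ≤ s) (G : Finset (ℕ × ℕ)) (hG : ∀ g ∈ G, IsFoldSlab m e g.1 g.2) :
    G.card ≤ f d (m * s) m := by
  obtain ⟨S, a, pt, hadm, hinj, hcp⟩ := exists_admissible hd hm hes
  refine le_trans ?_ (le_f hadm)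
  choose! i j hij x y hx hy hCP using hcp
  rw [← Set.ncard_coe_finset]
  have hfin : (A S a).Finite :=
    (closestPairsBetween_finite S a 0 (0 + m)).subset (A_subset_closestPairsBetween S a le_rfl)
  refine Set.ncard_le_ncard_of_injOn (fun g => CP S (a (i g.1 g.2)) (a (j g.1 g.2))) ?_ ?_ hfin
  · intro g hg
    exact ⟨_, _, hij _ _ (hG g hg), rfl⟩
  · intro g hg g' hg' h
    have hF := hG g hg
    have hF' := hG g' hg'
    simp only [hCP _ _ hF, hCP _ _ hF', WithTop.coe_inj, Sym2.eq_iff] at h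
    have h1 := hx _ _ hF
    have h2 := hy _ _ hF
    have h1' := hx _ _ hF'
    have h2' := hy _ _ hF'
    rcases h with ⟨hp, hq⟩ | ⟨hp, hq⟩
    · rw [hinj hp] at h1
      rw [hinj hq] at h2
      exact Prod.ext (h1.symm.trans h1') (h2.symm.trans h2')
    · rw [hinj hp] at h1
      rw [hinj hq] at h2
      have := hF.lt
      have := hF'.lt
      omega

/-- The number of fold slabs: on each of `t` levels of dyadic blocks, the number of blocks times the
number of symmetric positions is `2 ^ (e + t - 1)`, and there are `2 ^ e` shifts. -/
theorem exists_isFoldSlab_finset {m e t : ℕ} (hm : 2 ^ (e + 1 + t) ≤ m) :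
    ∃ G : Finset (ℕ × ℕ), (∀ g ∈ G, IsFoldSlab m e g.1 g.2) ∧
      2 * G.card = t * 2 ^ (2 * e + t) := by
  classical
  let Q : Finset (Σ _ : ℕ, ℕ × ℕ × ℕ) := (Finset.range t).sigma fun i =>
    Finset.range (2 ^ (t - 1 - i)) ×ˢ Finset.range (2 ^ (e + i)) ×ˢ Finset.range (2 ^ e)
  let mid : (Σ _ : ℕ, ℕ × ℕ × ℕ) → ℕ := fun z => 2 ^ (e + 1 + z.1) * (2 * z.2.1 + 1)
  let g : (Σ _ : ℕ, ℕ × ℕ × ℕ) → ℕ × ℕ := fun z =>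
    (mid z - 1 - z.2.2.1 - z.2.2.2, mid z + z.2.2.1 - z.2.2.2)
  have hmem : ∀ z ∈ Q, z.1 < t ∧ z.2.1 < 2 ^ (t - 1 - z.1) ∧ z.2.2.1 + 2 ^ e ≤ 2 ^ (e + 1 + z.1) ∧
      z.2.2.2 < 2 ^ e ∧ 2 ^ e ≤ 2 ^ (e + 1 + z.1) ∧ 2 ^ (e + 1 + z.1) ≤ mid z := by
    intro z hz
    simp only [Q, Finset.mem_sigma, Finset.mem_product, Finset.mem_range] at hz
    have h1 : 2 ^ e ≤ 2 ^ (e + z.1) := Nat.pow_le_pow_right (by norm_num) (by omega)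
    have h2 : 2 ^ (e + 1 + z.1) = 2 ^ (e + z.1) + 2 ^ (e + z.1) := by ring
    have h3 : 2 ^ (e + 1 + z.1) ≤ mid z := Nat.le_mul_of_pos_right _ (by omega)
    omega
  have hinj : Set.InjOn g Q := by
    have key : ∀ z ∈ Q, ∀ z' ∈ Q, z.1 ≤ z'.1 → g z = g z' → z = z' := by
      rintro ⟨l, k, r, τ⟩ hz ⟨l', k', r', τ'⟩ hz' hle h
      obtain ⟨h1, h2, h3, h4, h5, h6⟩ := hmem _ hz
      obtain ⟨h1', h2', h3', h4', h5', h6'⟩ := hmem _ hz'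
      simp only [g, Prod.mk.injEq] at h h1 h2 h3 h4 h5 h6 h1' h2' h3' h4' h5' h6' hle
      obtain ⟨hu, hv⟩ := h
      obtain rfl : r = r' := by omega
      have hdvd : 2 ^ (e + 1 + l) ∣ mid ⟨l, k, r, τ⟩ := Dvd.intro _ rfl
      have hdvd' : 2 ^ (e + 1 + l) ∣ mid ⟨l', k', r, τ'⟩ :=
        (pow_dvd_pow 2 (by simp only; omega)).trans (Dvd.intro _ rfl)
      have hmid : mid ⟨l, k, r, τ⟩ = mid ⟨l', k', r, τ'⟩ := by
        rcases le_total (mid ⟨l, k, r, τ⟩) (mid ⟨l', k', r, τ'⟩) with hle' | hle'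
        · have := Nat.eq_zero_of_dvd_of_lt (Nat.dvd_sub hdvd' hdvd) (by omega)
          omega
        · have := Nat.eq_zero_of_dvd_of_lt (Nat.dvd_sub hdvd hdvd') (by omega)
          omega
      have hτ : τ = τ' := by omega
      have hl : l = l' := by
        by_contra hne
        obtain ⟨c, rfl⟩ : ∃ c, l' = l + 1 + c := ⟨l' - l - 1, by omega⟩
        have h7 : 2 ^ (e + 1 + l) * (2 * k + 1) =
            2 ^ (e + 1 + l) * (2 * (2 ^ c * (2 * k' + 1))) := hmid.trans (by ring)
        have := Nat.eq_of_mul_eq_mul_left (by positivity) h7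
        omega
      subst hl hτ
      have h7 := Nat.eq_of_mul_eq_mul_left (by positivity) hmid
      obtain rfl : k = k' := by simp only at h7; omega
      rfl
    intro z hz z' hz' h
    rcases le_total z.1 z'.1 with hle | hle
    · exact key z hz z' hz' hle h
    · exact (key z' hz' z hz hle h.symm).symm
  refine ⟨Q.image g, ?_, ?_⟩
  · intro c hc
    obtain ⟨z, hz, rfl⟩ := Finset.mem_image.1 hc
    obtain ⟨h1, h2, h3, h4, h5, h6⟩ := hmem z hz
    have hmid : mid z = 2 ^ (e + 1 + z.1 + 1) * z.2.1 + 2 ^ (e + 1 + z.1) := by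
      simp only [mid]; ring
    refine ⟨e + 1 + z.1, 2 ^ (e + 1 + z.1 + 1) * z.2.1, z.2.2.1, z.2.2.2, Dvd.intro _ rfl, ?_, h3,
      h4, ?_, ?_⟩
    · calc 2 ^ (e + 1 + z.1 + 1) * z.2.1 + 2 ^ (e + 1 + z.1 + 1)
          = 2 ^ (e + 1 + z.1 + 1) * (z.2.1 + 1) := by ring
        _ ≤ 2 ^ (e + 1 + z.1 + 1) * 2 ^ (t - 1 - z.1) := Nat.mul_le_mul_left _ h2
        _ = 2 ^ (e + 1 + t) := by rw [← pow_add]; congr 1; omega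
        _ ≤ m := hm
    · simp only [g]; omega
    · simp only [g]; omega
  · rw [Finset.card_image_of_injOn hinj, Finset.card_sigma, Finset.mul_sum]
    rw [Finset.sum_congr rfl (g := fun _ => 2 ^ (2 * e + t)), Finset.sum_const, Finset.card_range,
      smul_eq_mul]
    intro i hi
    have hi' := Finset.mem_range.1 hi
    simp only [Finset.card_product, Finset.card_range]
    rw [← pow_add, ← pow_add, ← pow_succ']
    congr 1
    omega

theorem mul_two_pow_le_f {d : ℕ} [NeZero d] (hd : 2 ≤ d) {m s e t : ℕ} (hes : 2 ^ e ≤ s)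
    (hm : 2 ^ (e + 1 + t) ≤ m) : t * 2 ^ (2 * e + t) ≤ 2 * f d (m * s) m := by
  obtain ⟨G, hG, hcard⟩ := exists_isFoldSlab_finset hm
  rw [← hcard]
  exact Nat.mul_le_mul_left _ (card_le_f_of_isFoldSlab hd
    ((show 0 < 2 ^ (e + 1 + t) by positivity).trans_le hm) hes G hG)

theorem one_le_f {d : ℕ} [NeZero d] (hd : 2 ≤ d) {m s : ℕ} (hm : 0 < m) (hs : 0 < s) :
    1 ≤ f d (m * s) m := by
  obtain ⟨S, a, -, hadm, -⟩ := exists_admissible (s := s) (e := 0) hd hm (by rw [pow_zero]; exact hs)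
  refine le_trans ?_ (le_f hadm)
  have hfin : (A S a).Finite :=
    (closestPairsBetween_finite S a 0 (0 + m)).subset (A_subset_closestPairsBetween S a le_rfl)
  rw [Nat.one_le_iff_ne_zero, ← Nat.pos_iff_ne_zero, Set.ncard_pos hfin]
  exact ⟨_, ⟨0, by omega⟩, ⟨m, by omega⟩, by rw [Fin.lt_def]; exact hm, rfl⟩

/-! ### Asymptotics -/

theorem one_le_f_of_dvd {d : ℕ} [NeZero d] (hd : 2 ≤ d) {n m : ℕ} (hm : 1 ≤ m) (hmn : m ≤ n)
    (hdvd : m ∣ n) : 1 ≤ f d n m := by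
  obtain ⟨s, rfl⟩ := hdvd
  exact one_le_f hd hm (Nat.pos_of_mul_pos_left (hm.trans hmn))

/-- The fold slabs of a single level of dyadic blocks suffice for the lower bound when `m` is small:
with all usable shifts there are quadratically many of them, unless there are so few points in a
strip that the shifts are limited to `n / m`, which leaves linearly many in `n`. -/
theorem sq_le_f_or_le_f {d : ℕ} [NeZero d] (hd : 2 ≤ d) {n m : ℕ} (hm : 1 ≤ m) (hmn : m ≤ n)
    (hdvd : m ∣ n) : m ^ 2 ≤ 64 * f d n m ∨ n ≤ 16 * f d n m := by
  have hf := one_le_f_of_dvd hd hm hmn hdvd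
  rcases lt_or_ge m 4 with h4 | h4
  · left
    nlinarith
  obtain ⟨s, rfl⟩ := hdvd
  have hs : 0 < s := Nat.pos_of_mul_pos_left (hm.trans hmn)
  obtain ⟨k, hk⟩ : ∃ k, Nat.log 2 m = k + 2 :=
    Nat.exists_eq_add_of_le' (Nat.le_log_of_pow_le (by norm_num) (by simpa using h4))
  have hm1 : 2 ^ (k + 2) ≤ m := hk ▸ Nat.pow_log_le_self 2 (by omega)
  have hm2 : m < 2 ^ (k + 3) := by
    have := Nat.lt_pow_succ_log_self (b := 2) (by norm_num) m
    rwa [hk] at this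
  rcases le_or_gt (2 ^ k) s with hks | hks
  · left
    have h1 := mul_two_pow_le_f hd (t := 1) hks hm1
    have h2 : m ^ 2 ≤ (2 ^ (k + 3)) ^ 2 := Nat.pow_le_pow_left hm2.le 2
    have h3 : (2 ^ (k + 3)) ^ 2 = 32 * (1 * 2 ^ (2 * k + 1)) := by ring
    omega
  · right
    have hs1 : 2 ^ Nat.log 2 s ≤ s := Nat.pow_log_le_self 2 hs.ne'
    have hs2 : s < 2 ^ (Nat.log 2 s + 1) := Nat.lt_pow_succ_log_self (by norm_num) s
    generalize Nat.log 2 s = e at hs1 hs2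
    have hek : e < k := (Nat.pow_lt_pow_iff_right (by norm_num : 1 < 2)).1 (hs1.trans_lt hks)
    obtain ⟨c, rfl⟩ : ∃ c, k = e + c := ⟨k - e, by omega⟩
    have h1 := mul_two_pow_le_f hd (t := c + 1) hs1 (by convert hm1 using 2; ring)
    have h2 : m * s ≤ 2 ^ (e + c + 3) * 2 ^ (e + 1) := Nat.mul_le_mul hm2.le hs2.le
    have h3 : 2 ^ (e + c + 3) * 2 ^ (e + 1) = 8 * 2 ^ (2 * e + (c + 1)) := by ring
    have h4 : 1 * 2 ^ (2 * e + (c + 1)) ≤ (c + 1) * 2 ^ (2 * e + (c + 1)) :=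
      Nat.mul_le_mul_right _ (by omega)
    omega

/-- For `4 * √n ≤ m`, the logarithm of `m / √n` is the number `t` of useful levels of dyadic
blocks, up to constant factors. -/
theorem exists_dyadic_scales {m s : ℕ} (hm : 0 < m) (hs : 0 < s)
    (h : 4 * √((m * s : ℕ) : ℝ) ≤ m) : ∃ e t : ℕ, 2 ≤ t ∧ 2 ^ e ≤ s ∧ s < 2 ^ (e + 1) ∧
      2 ^ (e + 1 + t) ≤ m ∧ m < 2 ^ (e + 2 + t) ∧
      Real.log ((m : ℝ) / √((m * s : ℕ) : ℝ)) ≤ t ∧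
      (t : ℝ) ≤ 4 * Real.log ((m : ℝ) / √((m * s : ℕ) : ℝ)) := by
  have hmR : (0 : ℝ) < m := by exact_mod_cast hm
  have hsR : (0 : ℝ) < s := by exact_mod_cast hs
  have h16 : 16 * s ≤ m := by
    have h1 := pow_le_pow_left₀ (by positivity) h 2
    rw [mul_pow, Real.sq_sqrt (by positivity)] at h1
    push_cast at h1
    have h2 : (16 : ℝ) * s ≤ m := by nlinarith
    exact_mod_cast h2
  have hs1 : 2 ^ Nat.log 2 s ≤ s := Nat.pow_log_le_self 2 hs.ne'
  have hs2 : s < 2 ^ (Nat.log 2 s + 1) := Nat.lt_pow_succ_log_self (by norm_num) s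
  have hm1 : 2 ^ Nat.log 2 m ≤ m := Nat.pow_log_le_self 2 hm.ne'
  have hm2 : m < 2 ^ (Nat.log 2 m + 1) := Nat.lt_pow_succ_log_self (by norm_num) m
  generalize Nat.log 2 s = e at hs1 hs2
  generalize Nat.log 2 m = k at hm1 hm2
  have hek : e + 4 < k + 1 := by
    refine (Nat.pow_lt_pow_iff_right (by norm_num : 1 < 2)).1 ?_
    rw [pow_add]
    omega
  obtain ⟨t, rfl⟩ : ∃ t, k = e + 1 + t := ⟨k - e - 1, by omega⟩
  have hlog : Real.log ((m : ℝ) / √((m * s : ℕ) : ℝ)) = (Real.log m - Real.log s) / 2 := by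
    rw [Real.log_div hmR.ne' (by positivity), Real.log_sqrt (by positivity), Nat.cast_mul,
      Real.log_mul hmR.ne' hsR.ne']
    ring
  have hl2 := Real.log_two_gt_d9
  have hl2' := Real.log_two_lt_d9
  have hlogpow : ∀ j : ℕ, Real.log ((2 : ℝ) ^ j) = j * Real.log 2 := fun j => by
    rw [Real.log_pow]
  have a1 : (e : ℝ) * Real.log 2 ≤ Real.log s := by
    rw [← hlogpow]
    exact Real.log_le_log (by positivity) (by exact_mod_cast hs1)
  have a2 : Real.log s ≤ ((e : ℝ) + 1) * Real.log 2 := by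
    have := Real.log_le_log hsR (show (s : ℝ) ≤ 2 ^ (e + 1) by exact_mod_cast hs2.le)
    rw [hlogpow] at this
    exact_mod_cast this
  have a3 : ((e : ℝ) + 1 + t) * Real.log 2 ≤ Real.log m := by
    have := Real.log_le_log (by positivity) (show (2 : ℝ) ^ (e + 1 + t) ≤ m by exact_mod_cast hm1)
    rw [hlogpow] at this
    exact_mod_cast this
  have a4 : Real.log m ≤ ((e : ℝ) + 1 + t + 1) * Real.log 2 := by
    have := Real.log_le_log hmR (show (m : ℝ) ≤ 2 ^ (e + 1 + t + 1) by exact_mod_cast hm2.le)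
    rw [hlogpow] at this
    exact_mod_cast this
  have ht : 2 ≤ t := by omega
  have htR : (2 : ℝ) ≤ t := by exact_mod_cast ht
  refine ⟨e, t, ht, hs1, hs2, hm1, by convert hm2 using 2; ring, ?_, ?_⟩
  · rw [hlog]
    nlinarith
  · rw [hlog]
    nlinarith

theorem f_bounds_of_sqrt_le (d : ℕ) [NeZero d] (hd : 2 ≤ d) : ∃ c₁ c₂ : ℝ, 0 < c₁ ∧ 0 < c₂ ∧
    ∀ n m : ℕ, 1 ≤ m → m ≤ n → m ∣ n → 4 * √(n : ℝ) ≤ (m : ℝ) →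
      c₁ * ((n : ℝ) * Real.log ((m : ℝ) / √(n : ℝ))) ≤ (f d n m : ℝ) ∧
      (f d n m : ℝ) ≤ c₂ * ((n : ℝ) * Real.log ((m : ℝ) / √(n : ℝ))) := by
  obtain ⟨C, hC⟩ := exists_f_le d
  refine ⟨1 / 16, 8 * (1 + 2 * C), by norm_num, by positivity, ?_⟩
  rintro n m hm hmn ⟨s, rfl⟩ h
  have hs : 0 < s := Nat.pos_of_mul_pos_left (hm.trans hmn)
  obtain ⟨e, t, ht, hs1, hs2, hm1, hm2, hlow, hupp⟩ := exists_dyadic_scales hm hs h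
  generalize Real.log ((m : ℝ) / √((m * s : ℕ) : ℝ)) = x at hlow hupp
  have htR : (2 : ℝ) ≤ t := by exact_mod_cast ht
  constructor
  · have h1 := mul_two_pow_le_f hd hs1 hm1
    have h2 : m * s ≤ 2 ^ (e + 2 + t) * 2 ^ (e + 1) := Nat.mul_le_mul hm2.le hs2.le
    have h3 : 2 ^ (e + 2 + t) * 2 ^ (e + 1) = 8 * 2 ^ (2 * e + t) := by ring
    have h4 : t * (m * s) ≤ t * (8 * 2 ^ (2 * e + t)) := Nat.mul_le_mul_left _ (h2.trans h3.le)
    have h5 : t * (m * s) ≤ 16 * f d (m * s) m := by linarith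
    have h6 : (t : ℝ) * ((m * s : ℕ) : ℝ) ≤ 16 * (f d (m * s) m : ℝ) := by exact_mod_cast h5
    have h7 := mul_le_mul_of_nonneg_left hlow (Nat.cast_nonneg (α := ℝ) (m * s))
    linarith
  · have h1 := hC (m * s) m e (t + 2) (Dvd.intro s rfl)
      (by rwa [Nat.mul_div_cancel_left _ hm]) (by
        rw [show e + (t + 2) = e + 2 + t by ring]
        exact hm2.le)
    rw [Nat.mul_div_cancel_left _ hm] at h1
    have h2 : 2 ^ (e + (t + 2)) ≤ 2 * m := by
      have : 2 ^ (e + (t + 2)) = 2 * 2 ^ (e + 1 + t) := by ring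
      omega
    have h3 : f d (m * s) m ≤ 2 * m * s * (1 + C * (t + 2)) :=
      h1.trans (Nat.mul_le_mul_right _ (Nat.mul_le_mul_right _ h2))
    have h4 : (f d (m * s) m : ℝ) ≤ 2 * ((m * s : ℕ) : ℝ) * (1 + C * (t + 2)) := by
      have : (f d (m * s) m : ℝ) ≤ ((2 * m * s * (1 + C * (t + 2)) : ℕ) : ℝ) := by
        exact_mod_cast h3
      push_cast at this ⊢
      linarith
    have hCR : (0 : ℝ) ≤ C := Nat.cast_nonneg C
    have h5 : (1 : ℝ) + C * (t + 2) ≤ (1 + 2 * C) * (4 * x) :=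
      calc (1 : ℝ) + C * (t + 2) ≤ (1 + 2 * C) * t := by nlinarith
        _ ≤ (1 + 2 * C) * (4 * x) := by gcongr
    have h6 := mul_le_mul_of_nonneg_left h5
      (show (0 : ℝ) ≤ 2 * ((m * s : ℕ) : ℝ) by positivity)
    linarith

end SlabClosestPair

theorem theorem1 (d : ℕ) [NeZero d] (hd : 2 ≤ d) :
    (∀ C : ℝ, 0 < C → ∃ c₁ c₂ : ℝ, 0 < c₁ ∧ 0 < c₂ ∧
      ∀ n m : ℕ, 1 ≤ m → m ≤ n → m ∣ n → (m : ℝ) ≤ C * √(n : ℝ) →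
        c₁ * (m : ℝ) ^ 2 ≤ (SlabClosestPair.f d n m : ℝ) ∧
        (SlabClosestPair.f d n m : ℝ) ≤ c₂ * (m : ℝ) ^ 2) ∧
    (∃ K c₁ c₂ : ℝ, 1 < K ∧ 0 < c₁ ∧ 0 < c₂ ∧
      ∀ n m : ℕ, 1 ≤ m → m ≤ n → m ∣ n → K * √(n : ℝ) ≤ (m : ℝ) →
        c₁ * ((n : ℝ) * Real.log ((m : ℝ) / √(n : ℝ))) ≤ (SlabClosestPair.f d n m : ℝ) ∧
        (SlabClosestPair.f d n m : ℝ) ≤ c₂ * ((n : ℝ) * Real.log ((m : ℝ) / √(n : ℝ)))) ∧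
    (∃ c₁ c₂ : ℝ, 0 < c₁ ∧ 0 < c₂ ∧
      ∀ n : ℕ, 2 ≤ n →
        c₁ * ((n : ℝ) * Real.log (n : ℝ)) ≤ (SlabClosestPair.f d n n : ℝ) ∧
        (SlabClosestPair.f d n n : ℝ) ≤ c₂ * ((n : ℝ) * Real.log (n : ℝ))) := by
  have hsq : ∀ n m : ℕ, (SlabClosestPair.f d n m : ℝ) ≤ (m : ℝ) ^ 2 := fun n m => by
    exact_mod_cast SlabClosestPair.f_le_sq d n m
  obtain ⟨c₁, c₂, hc₁, hc₂, hlarge⟩ := SlabClosestPair.f_bounds_of_sqrt_le d hd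
  refine ⟨fun C hC => ?_, ⟨4, c₁, c₂, by norm_num, hc₁, hc₂, hlarge⟩, ?_⟩
  · refine ⟨min (1 / 64) (1 / (16 * C ^ 2)), 1, by positivity, one_pos, ?_⟩
    intro n m hm hmn hdvd hmC
    refine ⟨?_, by simpa using hsq n m⟩
    rcases SlabClosestPair.sq_le_f_or_le_f hd hm hmn hdvd with h | h
    · have h1 : (m : ℝ) ^ 2 ≤ 64 * (SlabClosestPair.f d n m : ℝ) := by exact_mod_cast h
      calc min (1 / 64) (1 / (16 * C ^ 2)) * (m : ℝ) ^ 2 ≤ 1 / 64 * (m : ℝ) ^ 2 := by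
            gcongr
            exact min_le_left _ _
        _ ≤ _ := by linarith
    · have h1 : (n : ℝ) ≤ 16 * (SlabClosestPair.f d n m : ℝ) := by exact_mod_cast h
      have h2 : (m : ℝ) ^ 2 ≤ C ^ 2 * n := by
        have := pow_le_pow_left₀ (Nat.cast_nonneg m) hmC 2
        rwa [mul_pow, Real.sq_sqrt (Nat.cast_nonneg n)] at this
      calc min (1 / 64) (1 / (16 * C ^ 2)) * (m : ℝ) ^ 2
          ≤ 1 / (16 * C ^ 2) * (C ^ 2 * (n : ℝ)) := by
            gcongr
            exact min_le_right _ _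
        _ = (n : ℝ) / 16 := by field_simp
        _ ≤ _ := by linarith
  · refine ⟨min (1 / 256) (c₁ / 2), 32 + c₂, by positivity, by positivity, ?_⟩
    intro n hn
    have hnR : (2 : ℝ) ≤ n := by exact_mod_cast hn
    have hlogn : 1 / 2 ≤ Real.log n :=
      le_trans (by linarith [Real.log_two_gt_d9]) (Real.log_le_log (by norm_num) hnR)
    have hpos : 0 ≤ (n : ℝ) * Real.log n := by positivity
    rcases lt_or_ge n 16 with h16 | h16
    · -- finitely many values of `n`, for which only the constants matter
      have hnR' : (n : ℝ) ≤ 16 := by exact_mod_cast h16.le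
      have hf : (1 : ℝ) ≤ SlabClosestPair.f d n n := by
        exact_mod_cast SlabClosestPair.one_le_f_of_dvd hd (by omega) le_rfl dvd_rfl
      constructor
      · have h1 : (n : ℝ) * Real.log n ≤ 16 * 16 := by
          have := Real.log_le_sub_one_of_pos (show (0 : ℝ) < n by linarith)
          exact mul_le_mul hnR' (by linarith) (by linarith) (by norm_num)
        calc min (1 / 256) (c₁ / 2) * ((n : ℝ) * Real.log n)
            ≤ 1 / 256 * (16 * 16) := by
              gcongr
              exact min_le_left _ _
          _ ≤ _ := by linarith
      · have h1 := hsq n n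
        have h2 := mul_nonneg hc₂.le hpos
        nlinarith
    · have h4 : 4 * √(n : ℝ) ≤ n := by
        have h16R : (16 : ℝ) ≤ n := by exact_mod_cast h16
        have h5 : 4 ≤ √(n : ℝ) := Real.le_sqrt_of_sq_le (by linarith)
        nlinarith [Real.mul_self_sqrt (Nat.cast_nonneg (α := ℝ) n)]
      have hlog : Real.log ((n : ℝ) / √(n : ℝ)) = Real.log n / 2 := by
        rw [Real.div_sqrt, Real.log_sqrt (Nat.cast_nonneg n)]
      obtain ⟨h1, h2⟩ := hlarge n n (by omega) le_rfl dvd_rfl h4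
      rw [hlog] at h1 h2
      constructor
      · calc min (1 / 256) (c₁ / 2) * ((n : ℝ) * Real.log n)
            ≤ c₁ / 2 * ((n : ℝ) * Real.log n) := by
              gcongr
              exact min_le_right _ _
          _ ≤ _ := by linarith
      · nlinarith
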